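/- Let $m\ge 1$ and $s\ge 1$ be integers and let $q_1,\dots,q_s$ be prime powers such that $2m \mid q_i+1$ for all $i$. For each $i$ let $G_i$ be an elementary abelian group of order $q_i^4$, and put $G=G_1\times\cdots\times G_s$ and $u=q_1^2q_2^2\cdots q_s^2$. For a subset $D\subseteq G$ with $0\notin D$ and $-D=D$, the Cayley graph $\mathrm{Cay}(G,D)$ has vertex set $G$, with $x,y$ adjacent if and only if $x-y\in D$. Then there are subsets $D_1,\dots,D_m\subseteq G$ with $0\notin D_x$ and $-D_x=D_x$ such that the graphs $\mathrm{Cay}(G,D_x)$, $x=1,\dots,m$, decompose the complete graph on $G$ (any two distinct vertices are adjacent in exactly one of them), and such that for every $i\in\{0,1,\dots,m\}$ and every $I\subseteq\{1,\dots,m\}$ with $|I|=i$ the following holds. The number $c=i(u-1)/m$ is a non-negative integer, and the graph $\Gamma_I=\mathrm{Cay}\bigl(G,\bigcup_{x\in I}D_x\bigr)$ has the negative Latin square type parameters $$(u^2,\ c(u+1),\ -u+c^2+3c,\ c^2+c),$$ that is: it has $u^2$ vertices, it is regular of valency $c(u+1)$, any two adjacent vertices have exactly $-u+c^2+3c$ common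 neighbours, and any two distinct non-adjacent vertices have exactly $c^2+c$ common neighbours. If $0<i<m$, then $\Gamma_I$ is neither edgeless nor complete, so it is a strongly regular graph; for $i=0$ and $i=m$ it is the edgeless and the complete graph, respectively, for which the condition on adjacent, respectively non-adjacent, pairs is empty. In particular, for every $i=0,1,\dots,m$ there is a Cayley graph on $G$ with these parameters for $c=i(u-1)/m$, and the complete graph on $G$ is decomposed by $m$ such Cayley graphs with $c=(u-1)/m$. -/

import Mathlib

/-- An (additively written) abelian group is elementary abelian if every element is killed by
one and the same prime `p`. -/
def IsElementaryAbelian (A : Type*) [AddCommGroup A] : Prop :=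
  ∃ p : ℕ, p.Prime ∧ ∀ a : A, p • a = 0

/-- Connection sets of Cayley graphs: subsets `D` with `0 ∉ D` and `-D = D`.  For such `D`, the
vertices `x`, `y` of `SimpleGraph.addCayley D` are adjacent iff `x - y ∈ D`. -/
def IsConnectionSet {A : Type*} [AddCommGroup A] (D : Set A) : Prop :=
  (0 : A) ∉ D ∧ ∀ d, -d ∈ D ↔ d ∈ D

theorem IsConnectionSet.addCayley_adj_iff {A : Type*} [AddCommGroup A] {D : Set A}
    (hD : IsConnectionSet D) (x y : A) :
    (SimpleGraph.addCayley D).Adj x y ↔ x - y ∈ D := by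
  rw [SimpleGraph.addCayley_adj']
  constructor
  · rintro ⟨-, g, hg, h | h⟩
    · have : x - y = -g := by rw [← h]; abel
      rw [this]
      exact (hD.2 g).2 hg
    · have : x - y = g := by rw [h]; abel
      rwa [this]
  · intro h
    refine ⟨?_, x - y, h, Or.inr (by abel)⟩
    rintro rfl
    exact hD.1 (by simpa using h)

open Classical in
/-- The graph `Γ` has the regularity properties of a strongly regular graph with negative Latin
square type parameters `(u², c(u+1), -u+c²+3c, c²+c)`.  The third parameter is an integer
equation, without truncation; it is the number of common neighbours of adjacent vertices, so it
is only required when `Γ` has an edge (it would be the negative integer `-u` when `c = 0`). -/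
def HasNegativeLatinSquareParameters {V : Type*} [Fintype V] (Γ : SimpleGraph V) (u c : ℕ) :
    Prop :=
  ∃ l : ℕ, (Γ ≠ ⊥ → (l : ℤ) = -(u : ℤ) + (c : ℤ) ^ 2 + 3 * (c : ℤ)) ∧
    Γ.IsSRGWith (u ^ 2) (c * (u + 1)) l (c ^ 2 + c)

/-!
The graphs are the colour classes of a colouring `f` of the nonzero elements of `G = ∏ i, G i` by
`ZMod m`. By orthogonality of the characters of `ZMod m`, a union of colour classes has the
nontrivial character values `c` and `c - u` required of a negative Latin square type graph if, for
every nontrivial character `θ` of `ZMod m`, the function `θ ∘ f` (extended by `0` at `0`) has the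
Fourier transform `0` at the trivial character and `-u θ(k)` at any other one, where the colour `k`
depends on the character of `G`, but not on `θ` (`IsNegativeColouring`). Strong regularity then
follows by Fourier inversion (`card_add_representations`).

Such colourings do not multiply: a product of two of them vanishes on too large a set and has the
wrong sign. They are therefore refined to `2 × 2` matrices of partial colourings
`M = !![F₀, E₁; E₀, F₁]` (`IsBuildingMatrix`), where `E₀ + E₁` is a colouring as above,
and `F₀`, `F₁` have Fourier transforms of the opposite sign and the value `1` at `0`.
At `0` the matrix `M` is diagonal, elsewhere only one of its columns is nonzero. Its Fourier
transform has the same shape, with rows in place of columns, and the sign `-1` off the diagonal.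
Diagonal and one-column matrices together form a monoid, and the signs arise from a conjugation by a
diagonal matrix, so the product `M x * N y` is again of this kind (`IsBuildingMatrix.prod`), and it
suffices to treat a single group `G i`, that is, the additive group of a field `K` with `q ^ 4`
elements.

Let `k < L < K` be the subfields of orders `q` and `q ^ 2`. The functions `E₀` and `E₁`
depend on the cyclotomic class of `x` modulo `2 m`, and are supported on the even and
the odd classes. Since `2 m ∣ q + 1`, they are constant on the sets `N x ∈ w k`, where `N` is the
norm from `K` to `L`; these sets are elliptic quadrics over `k`, whose character values come from
the Gauss sum of the norm form, by completing the square (`IsQuarticTower.sum_of_cone_invariant`). The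
functions `F₀` and `F₁` are constant on the lines of `K` over `L`, and the Fourier transform
moves the value on a line to the orthogonal line (`IsQuarticTower.sum_of_line_invariant`). There are
`(q ^ 2 + 1) / 2` even and as many odd lines, and this number is `1` modulo `m`, which lets the
colours of these lines add up to `1`. It is also odd, so passing to the orthogonal line
exchanges even and odd lines: this turns the columns of `M` into the rows of its transform.
-/

/-! ### Colour-valued matrices -/

/-- The ring in which colours modulo `m` live: functions on the nontrivial characters of
`ZMod m`, these being indexed by the nonzero `j : ZMod m`. -/
abbrev ColourRing (m : ℕ) : Type := {j : ZMod m // j ≠ 0} → ℂ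

/-- The element of `ColourRing m` that represents the colour `k`; its value at the character `j`
is the root of unity `exp (2πi j k / m)`. -/
noncomputable def colour {m : ℕ} [NeZero m] (k : ZMod m) : ColourRing m :=
  fun j => ZMod.stdAddChar (j.1 * k)

theorem colour_zero {m : ℕ} [NeZero m] : colour (0 : ZMod m) = 1 := by
  ext j; simp [colour]

theorem colour_add {m : ℕ} [NeZero m] (k l : ZMod m) :
    colour (k + l) = colour k * colour l := by
  ext j; simp [colour, mul_add, AddChar.map_add_eq_mul]

/-- The multiplicative monoid of the colours inside `ColourRing m`. -/
noncomputable def colours (m : ℕ) [NeZero m] : Submonoid (ColourRing m) where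
  carrier := Set.range colour
  one_mem' := ⟨0, colour_zero⟩
  mul_mem' := by
    rintro _ _ ⟨k, rfl⟩ ⟨l, rfl⟩
    exact ⟨k + l, colour_add k l⟩

theorem colour_mem {m : ℕ} [NeZero m] (k : ZMod m) : colour k ∈ colours m := ⟨k, rfl⟩

section Pattern

variable {R : Type*} [CommRing R] {U : Submonoid R} {B C : Matrix (Fin 2) (Fin 2) R}

/-- The matrix is diagonal, with diagonal entries in `U`. -/
def IsDiagonalIn (U : Submonoid R) (B : Matrix (Fin 2) (Fin 2) R) : Prop :=
  B 0 0 ∈ U ∧ B 0 1 = 0 ∧ B 1 0 = 0 ∧ B 1 1 ∈ U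

/-- One column of the matrix has its entries in `U`, the other column is zero. -/
def IsColumnIn (U : Submonoid R) (B : Matrix (Fin 2) (Fin 2) R) : Prop :=
  (B 0 0 ∈ U ∧ B 0 1 = 0 ∧ B 1 0 ∈ U ∧ B 1 1 = 0) ∨
    (B 0 0 = 0 ∧ B 0 1 ∈ U ∧ B 1 0 = 0 ∧ B 1 1 ∈ U)

/-- The matrix is diagonal over `U` if `z` holds, and supported on a single column over `U`
otherwise. -/
def HasPattern (U : Submonoid R) (z : Prop) (B : Matrix (Fin 2) (Fin 2) R) : Prop :=
  (z ∧ IsDiagonalIn U B) ∨ (¬z ∧ IsColumnIn U B)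

/-- The diagonal and the one-column matrices over `U` together form a monoid, in which a product
is diagonal only if both factors are.  This is what makes the product construction work. -/
theorem HasPattern.mul {z w : Prop} (hB : HasPattern U z B) (hC : HasPattern U w C) :
    HasPattern U (z ∧ w) (B * C) := by
  rcases hB with ⟨hz, h1, h2, h3, h4⟩ | ⟨hz, ⟨h1, h2, h3, h4⟩ | ⟨h1, h2, h3, h4⟩⟩ <;>
  rcases hC with ⟨hw, k1, k2, k3, k4⟩ | ⟨hw, ⟨k1, k2, k3, k4⟩ | ⟨k1, k2, k3, k4⟩⟩ <;>
  simp [HasPattern, IsDiagonalIn, IsColumnIn, Matrix.mul_apply, Fin.sum_univ_two, hz, hw, h1, h2,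
    h3, h4, k1, k2, k3, k4, mul_mem]

theorem hasPattern_one (z : Prop) (hz : z) : HasPattern U z (1 : Matrix (Fin 2) (Fin 2) R) :=
  Or.inl ⟨hz, by simp [IsDiagonalIn, one_mem]⟩

theorem HasPattern.congr {z w : Prop} (hB : HasPattern U z B) (h : z ↔ w) :
    HasPattern U w B := by
  simpa only [HasPattern, h] using hB

end Pattern

/-- The diagonal matrix with entries `1`, `-1`. -/
def signMatrix (R : Type*) [CommRing R] : Matrix (Fin 2) (Fin 2) R := !![1, 0; 0, -1]

theorem signMatrix_mul_self (R : Type*) [CommRing R] : signMatrix R * signMatrix R = 1 := by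
  ext i j; fin_cases i <;> fin_cases j <;> simp [signMatrix]

theorem signMatrix_conj {R : Type*} [CommRing R] (B : Matrix (Fin 2) (Fin 2) R) :
    signMatrix R * B * signMatrix R = !![B 0 0, -B 0 1; -B 1 0, B 1 1] := by
  ext i j
  fin_cases i <;> fin_cases j <;> simp [signMatrix, Matrix.mul_apply, Matrix.vecMul, dotProduct]

/-! ### Building matrices and their products -/

/-- A symmetric matrix-valued function on `A` that is diagonal at `0` and supported on one column
elsewhere, whose Fourier transform is, up to the factor `u` and a conjugation by the sign matrix,
diagonal at the trivial character and supported on one row at the others. The nonzero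
entries are colours in both cases. -/
structure IsBuildingMatrix {m : ℕ} [NeZero m] {A : Type*} [AddCommGroup A] [Fintype A] (u : ℕ)
    (M : A → Matrix (Fin 2) (Fin 2) (ColourRing m)) : Prop where
  pattern : ∀ x, HasPattern (colours m) (x = 0) (M x)
  neg : ∀ x, M (-x) = M x
  fourier : ∀ χ : AddChar A ℂ, ∃ B : Matrix (Fin 2) (Fin 2) (ColourRing m),
    HasPattern (colours m) (χ = 0) B.transpose ∧
    ∑ x, χ x • M x = (u : ℂ) • (signMatrix _ * B * signMatrix _)

namespace IsBuildingMatrix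

variable {m : ℕ} [NeZero m] {A B : Type*} [AddCommGroup A] [Fintype A] [AddCommGroup B]
  [Fintype B]

theorem comp_addEquiv {u : ℕ} {M : B → Matrix (Fin 2) (Fin 2) (ColourRing m)}
    (hM : IsBuildingMatrix u M) (e : A ≃+ B) : IsBuildingMatrix u (fun x => M (e x)) where
  pattern x := (hM.pattern (e x)).congr (by simp)
  neg x := by simp [hM.neg]
  fourier χ := by
    obtain ⟨C, hC, h⟩ := hM.fourier (χ.compAddMonoidHom (e.symm : B →+ A))
    refine ⟨C, hC.congr ?_, ?_⟩
    · simp only [AddChar.eq_zero_iff, AddChar.compAddMonoidHom_apply]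
      exact ⟨fun h x => by simpa using h (e x), fun h x => h _⟩
    · rw [← h]
      exact Fintype.sum_equiv e.toEquiv _ _ (by simp)

theorem of_unique [Unique A] : IsBuildingMatrix 1
    (fun _ : A => (1 : Matrix (Fin 2) (Fin 2) (ColourRing m))) where
  pattern x := hasPattern_one _ (Subsingleton.elim _ _)
  neg x := rfl
  fourier χ := by
    refine ⟨1, ?_, ?_⟩
    · rw [Matrix.transpose_one]
      refine hasPattern_one _ ?_
      rw [AddChar.eq_zero_iff]
      intro x
      rw [Subsingleton.elim x 0, AddChar.map_zero_eq_one]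
    · have h : χ default = 1 := by
        rw [Subsingleton.elim (default : A) 0, AddChar.map_zero_eq_one]
      simp [signMatrix_mul_self, h]

theorem prod {u v : ℕ} {M : A → Matrix (Fin 2) (Fin 2) (ColourRing m)}
    {N : B → Matrix (Fin 2) (Fin 2) (ColourRing m)}
    (hM : IsBuildingMatrix u M) (hN : IsBuildingMatrix v N) :
    IsBuildingMatrix (u * v) (fun x : A × B => M x.1 * N x.2) where
  pattern x := ((hM.pattern x.1).mul (hN.pattern x.2)).congr (by simp [Prod.ext_iff])
  neg x := by simp [hM.neg, hN.neg]
  fourier χ := by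
    obtain ⟨C, hC, h1⟩ := hM.fourier (χ.compAddMonoidHom (AddMonoidHom.inl A B))
    obtain ⟨D, hD, h2⟩ := hN.fourier (χ.compAddMonoidHom (AddMonoidHom.inr A B))
    have hχ : ∀ a b, χ (a, b) = χ (a, 0) * χ (0, b) := fun a b => by
      rw [← AddChar.map_add_eq_mul]; simp
    refine ⟨C * D, ?_, ?_⟩
    · rw [Matrix.transpose_mul]
      refine (hD.mul hC).congr ?_
      simp only [AddChar.eq_zero_iff, AddChar.compAddMonoidHom_apply, AddMonoidHom.inl_apply,
        AddMonoidHom.inr_apply, Prod.forall]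
      exact ⟨fun h a b => by rw [hχ, h.1, h.2, one_mul], fun h => ⟨fun b => h 0 b, fun a => h a 0⟩⟩
    · have : signMatrix (ColourRing m) * (C * D) * signMatrix _ =
          (signMatrix _ * C * signMatrix _) * (signMatrix _ * D * signMatrix _) := by
        calc _ = signMatrix (ColourRing m) * C * 1 * D * signMatrix _ := by
              simp only [Matrix.mul_assoc, Matrix.one_mul]
          _ = _ := by simp only [← signMatrix_mul_self, Matrix.mul_assoc]
      rw [this, Nat.cast_mul, ← smul_mul_smul_comm, ← h1, ← h2, Finset.sum_mul_sum,
        Fintype.sum_prod_type]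
      refine Finset.sum_congr rfl fun a _ => Finset.sum_congr rfl fun b _ => ?_
      rw [hχ, smul_mul_smul_comm]
      simp

theorem exists_pi : ∀ (s : ℕ) (G : Fin s → Type*) [∀ i, AddCommGroup (G i)] [∀ i, Fintype (G i)]
    (u : Fin s → ℕ) (_ : ∀ i, ∃ M : G i → Matrix (Fin 2) (Fin 2) (ColourRing m),
      IsBuildingMatrix (u i) M),
    ∃ M : (∀ i, G i) → Matrix (Fin 2) (Fin 2) (ColourRing m), IsBuildingMatrix (∏ i, u i) M
  | 0, _, _, _, _, _ => by
    simpa using ⟨_, of_unique⟩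
  | s + 1, G, _, _, u, h => by
    obtain ⟨M, hM⟩ := h 0
    obtain ⟨N, hN⟩ := exists_pi s (fun i => G i.succ) (fun i => u i.succ) (fun i => h i.succ)
    rw [Fin.prod_univ_succ]
    exact ⟨_, (hM.prod hN).comp_addEquiv (Fin.consLinearEquiv ℤ G).symm.toAddEquiv⟩

end IsBuildingMatrix

/-! ### Strongly regular Cayley graphs from character values -/

section CayleyGraph

variable {A : Type*} [AddCommGroup A] [Fintype A]

/-- A function on a finite abelian group whose Fourier transform vanishes is zero. -/
theorem eq_zero_of_forall_sum_addChar_mul_eq_zero (f : A → ℂ)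
    (h : ∀ χ : AddChar A ℂ, ∑ x, χ x * f x = 0) : f = 0 := by
  classical
  funext y
  have h1 : ∑ χ : AddChar A ℂ, χ (-y) * ∑ x, χ x * f x = (Fintype.card A : ℂ) * f y := by
    simp_rw [Finset.mul_sum, ← mul_assoc, ← AddChar.map_add_eq_mul]
    rw [Finset.sum_comm]
    simp_rw [← Finset.sum_mul, AddChar.sum_apply_eq_ite]
    simp [neg_add_eq_zero]
  simp only [h, mul_zero, Finset.sum_const_zero] at h1
  simpa using h1.symm

open Classical in
/-- The number of representations of `z` as a sum of two elements of `D`, if all nontrivial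
character values of `D` are `c` or `c - u`: the two values are the roots of a quadratic
polynomial, and the Fourier transform turns this into an identity for the convolution square. -/
theorem card_add_representations (D : Finset A) (u c : ℕ)
    (hu : Fintype.card A = u ^ 2) (hcard : D.card = c * (u + 1))
    (hχ : ∀ χ : AddChar A ℂ, χ ≠ 0 → ∑ x ∈ D, χ x = c ∨ ∑ x ∈ D, χ x = (c : ℂ) - u) (z : A) :
    ((D.filter fun d => z - d ∈ D).card : ℂ) = (c ^ 2 + c) +
      (2 * c - u) * (if z ∈ D then 1 else 0) + (c * u - c ^ 2) * (if z = 0 then 1 else 0) := by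
  have key := eq_zero_of_forall_sum_addChar_mul_eq_zero
    (fun z : A => ((D.filter fun d => z - d ∈ D).card : ℂ) - ((c ^ 2 + c) +
      (2 * c - u) * (if z ∈ D then 1 else 0) + (c * u - c ^ 2) * (if z = 0 then 1 else 0))) ?_
  · exact sub_eq_zero.1 (congrFun key z)
  intro χ
  have h1 : ∑ x, χ x * ((D.filter fun d => x - d ∈ D).card : ℂ) = (∑ x ∈ D, χ x) ^ 2 := by
    have : ∀ x, χ x * ((D.filter fun d => x - d ∈ D).card : ℂ) =
        ∑ d ∈ D, if x - d ∈ D then χ x else 0 := fun x => by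
      rw [← Finset.sum_filter, Finset.sum_const, nsmul_eq_mul, mul_comm]
    simp_rw [this]
    rw [Finset.sum_comm, sq, Finset.sum_mul]
    refine Finset.sum_congr rfl fun d _ => ?_
    rw [Finset.mul_sum, ← Finset.sum_filter]
    refine Finset.sum_bij' (fun x _ => x - d) (fun x _ => x + d) ?_ ?_ ?_ ?_ ?_
    · intro x hx; simpa using hx
    · intro x hx; simpa using hx
    · intro x _; simp
    · intro x _; simp
    · intro x _; rw [← AddChar.map_add_eq_mul]; simp
  have h2 : ∑ x, χ x * (if x ∈ D then 1 else 0 : ℂ) = ∑ x ∈ D, χ x := by simp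
  have h3 : ∑ x, χ x * (if x = 0 then 1 else 0 : ℂ) = 1 := by simp
  have h4 : ∑ x, χ x = if χ = 0 then (u : ℂ) ^ 2 else 0 := by
    rw [AddChar.sum_eq_ite, hu]; push_cast; rfl
  have h5 : ∀ x, χ x * (((D.filter fun d => x - d ∈ D).card : ℂ) - ((c ^ 2 + c) +
      (2 * c - u) * (if x ∈ D then 1 else 0) + (c * u - c ^ 2) * (if x = 0 then 1 else 0))) =
      χ x * ((D.filter fun d => x - d ∈ D).card : ℂ) - (χ x * (c ^ 2 + c) +
      χ x * (if x ∈ D then 1 else 0) * (2 * c - u) +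
      χ x * (if x = 0 then 1 else 0) * (c * u - c ^ 2)) := fun x => by ring
  simp_rw [h5]
  rw [Finset.sum_sub_distrib, Finset.sum_add_distrib, Finset.sum_add_distrib, ← Finset.sum_mul,
    ← Finset.sum_mul, ← Finset.sum_mul, h1, h2, h3, h4]
  by_cases h0 : χ = 0
  · have : ∑ x ∈ D, χ x = c * (u + 1) := by
      subst h0; simp [hcard]
    rw [if_pos h0, this]; ring
  · rw [if_neg h0]
    rcases hχ χ h0 with h | h <;> rw [h] <;> ring

theorem hasNegativeLatinSquareParameters_of_adj_iff {D : Set A} (hD : IsConnectionSet D)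
    (Γ : SimpleGraph A) (hΓ : ∀ x y, Γ.Adj x y ↔ x - y ∈ D) (u c : ℕ)
    (hu : Fintype.card A = u ^ 2) (D' : Finset A) (hD' : ∀ x, x ∈ D' ↔ x ∈ D)
    (hcard : D'.card = c * (u + 1))
    (hχ : ∀ χ : AddChar A ℂ, χ ≠ 0 → ∑ x ∈ D', χ x = c ∨ ∑ x ∈ D', χ x = (c : ℂ) - u) :
    HasNegativeLatinSquareParameters Γ u c := by
  classical
  have rep := card_add_representations D' u c hu hcard hχ
  have common : ∀ v w, ((Fintype.card (Γ.commonNeighbors v w) : ℕ)) =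
      (D'.filter fun d => v - w - d ∈ D').card := by
    intro v w
    rw [← Set.toFinset_card]
    refine Finset.card_bij' (fun y _ => v - y) (fun d _ => v - d) ?_ ?_ ?_ ?_
    · intro y hy
      simp only [Set.mem_toFinset, SimpleGraph.mem_commonNeighbors, hΓ] at hy
      simp only [Finset.mem_filter, hD']
      refine ⟨hy.1, ?_⟩
      rw [← hD.2]
      convert hy.2 using 1
      abel
    · intro d hd
      simp only [Finset.mem_filter, hD'] at hd
      simp only [Set.mem_toFinset, SimpleGraph.mem_commonNeighbors, hΓ]
      refine ⟨by simpa using hd.1, ?_⟩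
      rw [← hD.2]
      convert hd.2 using 1
      abel
    · intro y _; simp
    · intro d _; simp
  have hl : Γ ≠ ⊥ → ((-(u : ℤ) + (c : ℤ) ^ 2 + 3 * (c : ℤ)).toNat : ℤ) =
      -(u : ℤ) + (c : ℤ) ^ 2 + 3 * (c : ℤ) := by
    intro hne
    obtain ⟨v, w, hvw⟩ := SimpleGraph.ne_bot_iff_exists_adj.1 hne
    rw [hΓ] at hvw
    have h0 : v - w ≠ 0 := fun h => hD.1 (h ▸ hvw)
    have := rep (v - w)
    rw [if_pos ((hD' _).2 hvw), if_neg h0] at this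
    apply Int.toNat_of_nonneg
    have h2 : (((D'.filter fun d => v - w - d ∈ D').card : ℤ) : ℂ) =
        ((-(u : ℤ) + (c : ℤ) ^ 2 + 3 * (c : ℤ) : ℤ) : ℂ) := by
      push_cast; rw [this]; ring
    rw [← Int.cast_inj.1 h2]
    positivity
  refine ⟨_, hl, SimpleGraph.IsSRGWith.mk ?_ ?_ ?_ ?_⟩
  · exact hu
  · intro v
    rw [← hcard, ← SimpleGraph.card_neighborFinset_eq_degree]
    refine Finset.card_bij' (fun y _ => v - y) (fun d _ => v - d) ?_ ?_ ?_ ?_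
    · intro y hy
      simpa [hD', hΓ] using hy
    · intro d hd
      simpa [hD', hΓ] using hd
    · intro y _; simp
    · intro d _; simp
  · intro v w hvw
    have hne : Γ ≠ ⊥ := SimpleGraph.ne_bot_iff_exists_adj.2 ⟨v, w, hvw⟩
    rw [hΓ] at hvw
    have h0 : v - w ≠ 0 := fun h => hD.1 (h ▸ hvw)
    have := rep (v - w)
    rw [if_pos ((hD' _).2 hvw), if_neg h0, ← common] at this
    have h2 : ((Fintype.card (Γ.commonNeighbors v w) : ℤ) : ℂ) =
        ((-(u : ℤ) + (c : ℤ) ^ 2 + 3 * (c : ℤ) : ℤ) : ℂ) := by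
      push_cast; rw [this]; ring
    have h3 := Int.cast_inj.1 h2
    rw [← hl hne] at h3
    exact_mod_cast h3
  · intro v w hne hvw
    rw [hΓ] at hvw
    have := rep (v - w)
    rw [if_neg (mt (hD' _).1 hvw), if_neg (sub_ne_zero.2 hne), ← common] at this
    have h2 : (Fintype.card (Γ.commonNeighbors v w) : ℂ) =
        ((c ^ 2 + c : ℕ) : ℂ) := by
      push_cast; rw [this]; ring
    exact_mod_cast h2

end CayleyGraph

/-! ### The colouring defined by a building matrix -/

section Colouring

variable {A : Type*} [AddCommGroup A] [Fintype A] {m : ℕ} [NeZero m]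

open Classical in
/-- A symmetric colouring of the nonzero elements of `A` by `ZMod m`. Conditions `sum_zero`
and `fourier` say that for each nontrivial character `t ↦ exp (2πi j t / m)` of the group
of colours, the composite with the colouring has Fourier transform `0` at the trivial character
of `A`, and `-u` times a colour, which is the same for all `j`, at each nontrivial one. -/
structure IsNegativeColouring (u : ℕ) (f : A → ZMod m) : Prop where
  neg : ∀ x, f (-x) = f x
  sum_zero : ∀ j : ZMod m, j ≠ 0 → ∑ x with x ≠ 0, (ZMod.stdAddChar (j * f x) : ℂ) = 0
  fourier : ∀ χ : AddChar A ℂ, χ ≠ 0 → ∃ k : ZMod m, ∀ j : ZMod m, j ≠ 0 →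
    ∑ x with x ≠ 0, χ x * (ZMod.stdAddChar (j * f x) : ℂ) = -u * ZMod.stdAddChar (j * k)

theorem IsBuildingMatrix.exists_colouring {u : ℕ}
    {M : A → Matrix (Fin 2) (Fin 2) (ColourRing m)} (hM : IsBuildingMatrix u M) :
    ∃ f : A → ZMod m, IsNegativeColouring u f := by
  classical
  have h0 : M 0 0 1 + M 0 1 0 = 0 := by
    rcases hM.pattern 0 with ⟨_, _, h2, h3, _⟩ | ⟨h, _⟩
    · simp [h2, h3]
    · exact absurd rfl h
  have h1 : ∀ x, x ≠ 0 → ∃ k : ZMod m, colour k = M x 0 1 + M x 1 0 := by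
    intro x hx
    rcases hM.pattern x with ⟨h, _⟩ | ⟨_, ⟨_, h2, ⟨k, h3⟩, _⟩ | ⟨_, ⟨k, h2⟩, h3, _⟩⟩
    · exact absurd h hx
    · exact ⟨k, by rw [h3, h2, zero_add]⟩
    · exact ⟨k, by rw [h2, h3, add_zero]⟩
  let f : A → ZMod m := fun x =>
    Function.invFun (colour : ZMod m → ColourRing m) (M x 0 1 + M x 1 0)
  have hf : ∀ x, x ≠ 0 → colour (f x) = M x 0 1 + M x 1 0 := fun x hx =>
    Function.invFun_eq (h1 x hx)
  have hsum : ∀ (χ : AddChar A ℂ) (j : ZMod m) (hj : j ≠ 0),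
      ∑ x with x ≠ 0, χ x * (ZMod.stdAddChar (j * f x) : ℂ) =
        ((∑ x, χ x • M x) 0 1 + (∑ x, χ x • M x) 1 0) ⟨j, hj⟩ := by
    intro χ j hj
    simp only [Matrix.sum_apply, Matrix.smul_apply, ← Finset.sum_add_distrib, ← smul_add,
      Finset.sum_apply, Pi.smul_apply, smul_eq_mul]
    rw [Finset.sum_filter]
    refine Finset.sum_congr rfl fun x _ => ?_
    by_cases hx : x = 0
    · simpa [hx] using (congrFun h0 ⟨j, hj⟩).symm
    · rw [if_pos hx, ← hf x hx]; rfl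
  refine ⟨f, ⟨fun x => by simp only [f, hM.neg], fun j hj => ?_, fun χ hχ => ?_⟩⟩
  · obtain ⟨B, hB, h⟩ := hM.fourier 0
    have h2 := hsum 0 j hj
    rw [h] at h2
    rcases hB with ⟨_, _, hb, hc, _⟩ | ⟨hn, _⟩
    · simp only [Matrix.transpose_apply] at hb hc
      simpa [signMatrix_conj, hb, hc] using h2
    · exact absurd rfl hn
  · obtain ⟨B, hB, h⟩ := hM.fourier χ
    have h2 := hsum χ
    rw [h] at h2
    rcases hB with ⟨hn, _⟩ | ⟨_, ⟨_, hc, ⟨k, hb⟩, _⟩ | ⟨_, ⟨k, hb⟩, hc, _⟩⟩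
    · exact absurd hn hχ
    all_goals
      simp only [Matrix.transpose_apply] at hb hc
      refine ⟨k, fun j hj => ?_⟩
      rw [h2 j hj]
      simp [signMatrix_conj, ← hb, hc, colour]

namespace IsNegativeColouring

variable {u : ℕ} {f : A → ZMod m}

open Classical in
/-- Expansion of the indicator function of a colour class in characters of `ZMod m`. -/
theorem mul_sum_class (f : A → ZMod m) (χ : AddChar A ℂ) (k : ZMod m) :
    (m : ℂ) * ∑ x with x ≠ 0 ∧ f x = k, χ x =
      ∑ j : ZMod m, ZMod.stdAddChar (-(j * k)) *
        ∑ x with x ≠ 0, χ x * (ZMod.stdAddChar (j * f x) : ℂ) := by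
  have h : ∀ x, ∑ j : ZMod m, (ZMod.stdAddChar (-(j * k)) : ℂ) * (χ x * ZMod.stdAddChar (j * f x))
      = χ x * if f x = k then (m : ℂ) else 0 := by
    intro x
    have := AddChar.sum_mulShift (f x - k) (ZMod.isPrimitive_stdAddChar m)
    rw [ZMod.card] at this
    simp only [sub_eq_zero] at this
    push_cast at this
    rw [← this, Finset.mul_sum]
    refine Finset.sum_congr rfl fun j _ => ?_
    rw [mul_left_comm, ← AddChar.map_add_eq_mul]
    congr 2; ring
  simp_rw [Finset.mul_sum]
  rw [Finset.sum_comm]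
  simp_rw [h]
  rw [← Finset.filter_filter, Finset.sum_filter]
  refine Finset.sum_congr rfl fun x _ => ?_
  split_ifs <;> ring

open Classical in
theorem mul_sum_class_zero (hf : IsNegativeColouring u f) (hA : Fintype.card A = u ^ 2)
    (k : ZMod m) :
    (m : ℂ) * (Finset.univ.filter fun x => x ≠ 0 ∧ f x = k).card = (u : ℂ) ^ 2 - 1 := by
  have h := mul_sum_class f 0 k
  rw [Fintype.sum_eq_single 0] at h
  · have h0 : ((Finset.univ.filter fun x : A => x ≠ 0).card : ℂ) = (u : ℂ) ^ 2 - 1 := by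
      rw [Finset.filter_ne', Finset.card_erase_of_mem (Finset.mem_univ _), Finset.card_univ,
        Nat.cast_pred Fintype.card_pos, hA]
      push_cast; rfl
    simpa [h0] using h
  · intro j hj
    simp only [AddChar.zero_apply, one_mul]
    rw [hf.sum_zero j hj, mul_zero]

open Classical in
theorem exists_mul_sum_class (hf : IsNegativeColouring u f) {χ : AddChar A ℂ} (hχ : χ ≠ 0) :
    ∃ l : ZMod m, ∀ k : ZMod m, (m : ℂ) * ∑ x with x ≠ 0 ∧ f x = k, χ x =
      (u - 1) - m * (if l = k then (u : ℂ) else 0) := by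
  obtain ⟨l, hl⟩ := hf.fourier χ hχ
  refine ⟨l, fun k => ?_⟩
  have h0 : ∑ x with x ≠ 0, χ x = -1 := by
    have h1 := AddChar.sum_eq_ite χ
    rw [if_neg hχ, Fintype.sum_eq_add_sum_compl 0, AddChar.map_zero_eq_one] at h1
    rw [Finset.filter_ne', ← Finset.compl_singleton]
    linear_combination h1
  have h1 := AddChar.sum_mulShift (l - k) (ZMod.isPrimitive_stdAddChar m)
  rw [Fintype.sum_eq_add_sum_compl 0, zero_mul, AddChar.map_zero_eq_one, ZMod.card] at h1
  simp only [sub_eq_zero] at h1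
  rw [mul_sum_class, Fintype.sum_eq_add_sum_compl 0]
  simp only [zero_mul, neg_zero, AddChar.map_zero_eq_one, mul_one, one_mul]
  rw [h0]
  have h2 : ∀ j ∈ ({0}ᶜ : Finset (ZMod m)), ZMod.stdAddChar (-(j * k)) *
      ∑ x with x ≠ 0, χ x * (ZMod.stdAddChar (j * f x) : ℂ) =
      -u * ZMod.stdAddChar (j * (l - k)) := by
    intro j hj
    rw [hl j (by simpa using hj), mul_left_comm, ← AddChar.map_add_eq_mul]
    congr 2; ring
  rw [Finset.sum_congr rfl h2, ← Finset.mul_sum]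
  split_ifs at h1 ⊢ with hlk
  · linear_combination -(u : ℂ) * h1
  · linear_combination -(u : ℂ) * h1

/-- Unions of colour classes of a negative colouring have the character values of a strongly
regular graph of negative Latin square type, since at every nontrivial character only one of the
classes has the exceptional value. -/
theorem exists_decomposition (hf : IsNegativeColouring u f) (hA : Fintype.card A = u ^ 2)
    (hu : 1 < u) (hmu : m ∣ u - 1) :
    ∃ D : Fin m → Set A, (∀ x, IsConnectionSet (D x)) ∧
      (∀ a b : A, a ≠ b → ∃! x, (SimpleGraph.addCayley (D x)).Adj a b) ∧
      ∀ I : Finset (Fin m), ∃ c : ℕ, (m : ℤ) * c = I.card * ((u : ℤ) - 1) ∧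
        IsConnectionSet (⋃ x ∈ I, D x) ∧
        HasNegativeLatinSquareParameters (SimpleGraph.addCayley (⋃ x ∈ I, D x)) u c ∧
        (0 < I.card → I.card < m →
          SimpleGraph.addCayley (⋃ x ∈ I, D x) ≠ ⊥ ∧
          SimpleGraph.addCayley (⋃ x ∈ I, D x) ≠ ⊤) := by
  classical
  have hm0 : (m : ℂ) ≠ 0 := Nat.cast_ne_zero.2 (NeZero.ne m)
  let σ : Fin m ≃ ZMod m := Fintype.equivOfCardEq (by simp)
  let D : Fin m → Set A := fun x => {a | a ≠ 0 ∧ f a = σ x}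
  have hD : ∀ x, IsConnectionSet (D x) := fun x =>
    ⟨fun h => h.1 rfl, fun d => by simp [D, hf.neg]⟩
  have hDI : ∀ I : Finset (Fin m), IsConnectionSet (⋃ x ∈ I, D x) := fun I => by
    refine ⟨?_, fun d => ?_⟩
    · simp only [Set.mem_iUnion, not_exists]
      exact fun x _ => (hD x).1
    · simp only [Set.mem_iUnion, (hD _).2]
  have hne : ∀ x, (D x).Nonempty := by
    intro x
    by_contra h
    have h1 := hf.mul_sum_class_zero hA (σ x)
    have h2 : (Finset.univ.filter fun a => a ≠ 0 ∧ f a = σ x) = ∅ := by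
      ext a
      simp only [Finset.mem_filter, Finset.mem_univ, true_and, Finset.notMem_empty, iff_false]
      exact fun ha => h ⟨a, ha⟩
    rw [h2, Finset.card_empty, Nat.cast_zero, mul_zero, eq_comm, sub_eq_zero] at h1
    have h3 : u ^ 2 = 1 := by exact_mod_cast h1
    nlinarith
  refine ⟨D, hD, ?_, fun I => ?_⟩
  · intro a b hab
    refine ⟨σ.symm (f (a - b)), ?_, ?_⟩
    · exact ((hD _).addCayley_adj_iff _ _).2 ⟨sub_ne_zero.2 hab, by simp⟩
    · intro x hx
      rw [(hD _).addCayley_adj_iff] at hx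
      rw [hx.2, Equiv.symm_apply_apply]
  obtain ⟨t, ht⟩ := hmu
  have hut : (u : ℂ) - 1 = m * t := by
    rw [← Nat.cast_mul, ← ht, Nat.cast_pred (by omega)]
  refine ⟨I.card * t, ?_, hDI I, ?_, ?_⟩
  · have : (u : ℤ) - 1 = m * t := by
      rw [← Nat.cast_mul, ← ht, Nat.cast_pred (by omega)]
    rw [this]; push_cast; ring
  · have hmem : ∀ a, a ∈ I.biUnion (fun x => Finset.univ.filter fun a => a ≠ 0 ∧ f a = σ x) ↔
        a ∈ ⋃ x ∈ I, D x := fun a => by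
      simp only [Finset.mem_biUnion, Finset.mem_filter, Finset.mem_univ, true_and, Set.mem_iUnion,
        exists_prop]
      rfl
    have hdisj : (I : Set (Fin m)).PairwiseDisjoint
        (fun x => Finset.univ.filter fun a : A => a ≠ 0 ∧ f a = σ x) := by
      intro x _ y _ hxy
      refine Finset.disjoint_left.2 fun a ha hb => hxy ?_
      simp only [Finset.mem_filter] at ha hb
      exact σ.injective (ha.2.2.symm.trans hb.2.2)
    refine hasNegativeLatinSquareParameters_of_adj_iff (hDI I) _ (hDI I).addCayley_adj_iff
      u _ hA _ hmem ?_ ?_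
    · rw [Finset.card_biUnion hdisj]
      have : ∀ x ∈ I, (Finset.univ.filter fun a : A => a ≠ 0 ∧ f a = σ x).card =
          t * (u + 1) := by
        intro x _
        have h1 := hf.mul_sum_class_zero hA (σ x)
        have h2 : (m : ℂ) * (Finset.univ.filter fun a : A => a ≠ 0 ∧ f a = σ x).card =
            m * ((t * (u + 1) : ℕ) : ℂ) := by
          rw [h1]; push_cast; linear_combination (u + 1 : ℂ) * hut
        exact_mod_cast mul_left_cancel₀ hm0 h2
      rw [Finset.sum_congr rfl this, Finset.sum_const, smul_eq_mul, mul_assoc]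
    · intro χ hχ
      obtain ⟨l, hl⟩ := hf.exists_mul_sum_class hχ
      have h1 : ∀ x ∈ I, ∑ a with a ≠ 0 ∧ f a = σ x, χ a =
          t - (if σ.symm l = x then (u : ℂ) else 0) := by
        intro x _
        apply mul_left_cancel₀ hm0
        rw [hl, hut, mul_sub]
        simp only [Equiv.symm_apply_eq]
      rw [Finset.sum_biUnion hdisj, Finset.sum_congr rfl h1, Finset.sum_sub_distrib,
        Finset.sum_const, Finset.sum_ite_eq, nsmul_eq_mul]
      push_cast
      split_ifs
      · exact Or.inr rfl
      · exact Or.inl (sub_zero _)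
  · intro h0 h1
    constructor
    · obtain ⟨x, hx⟩ := Finset.card_pos.1 h0
      obtain ⟨a, ha⟩ := hne x
      refine SimpleGraph.ne_bot_iff_exists_adj.2 ⟨a, 0, ?_⟩
      rw [(hDI I).addCayley_adj_iff, sub_zero]
      exact Set.mem_biUnion hx ha
    · obtain ⟨x, hx⟩ : ∃ x, x ∉ I := by
        by_contra! h
        rw [Finset.eq_univ_of_forall h, Finset.card_univ, Fintype.card_fin] at h1
        exact lt_irrefl _ h1
      obtain ⟨a, ha⟩ := hne x
      intro htop
      have h2 : (SimpleGraph.addCayley (⋃ x ∈ I, D x)).Adj a 0 := by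
        rw [htop]; exact ha.1
      rw [(hDI I).addCayley_adj_iff, sub_zero, Set.mem_iUnion₂] at h2
      obtain ⟨y, hy, hay⟩ := h2
      exact hx (σ.injective (ha.2.symm.trans hay.2) ▸ hy)

end IsNegativeColouring

end Colouring

/-! ### Character sums over a field with `q ^ 4` elements -/

section CharacterSums

variable {K : Type*} [Field K] [Fintype K]

/-- `k ≤ L ≤ K` is the tower of the finite fields of orders `q`, `q ^ 2` and `q ^ 4`, and `q` is
odd. The conjugation of `K` over `L` is `x ↦ x ^ q ^ 2`, the norm is `x ↦ x ^ (q ^ 2 + 1)`. -/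
structure IsQuarticTower (q : ℕ) (k L : Subfield K) : Prop where
  one_lt : 1 < q
  two_ne_zero : (2 : K) ≠ 0
  mem_bot : ∀ x, x ∈ k ↔ x ^ q = x
  mem_mid : ∀ x, x ∈ L ↔ x ^ q ^ 2 = x
  card_bot : Nat.card k = q
  card_mid : Nat.card L = q ^ 2
  card_top : Fintype.card K = q ^ 4
  add_pow : ∀ x y : K, (x + y) ^ q ^ 2 = x ^ q ^ 2 + y ^ q ^ 2

namespace IsQuarticTower

variable {q : ℕ} {k L : Subfield K} (h : IsQuarticTower q k L)
include h

theorem pow_pow (x : K) : (x ^ q ^ 2) ^ q ^ 2 = x := by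
  rw [← pow_mul, ← pow_add, ← h.card_top, FiniteField.pow_card]

theorem one_lt_sq : 1 < q ^ 2 := Nat.one_lt_pow (by norm_num) h.one_lt

theorem sq_sub_one_ne_zero : ((q : ℂ) ^ 2 - 1) ≠ 0 := by
  have := h.one_lt_sq
  intro h0
  have : q ^ 2 = 1 := by exact_mod_cast sub_eq_zero.1 h0
  omega

theorem norm_mem (x : K) : x ^ (q ^ 2 + 1) ∈ L := by
  rw [h.mem_mid, pow_succ, mul_pow, h.pow_pow, mul_comm]

theorem bot_le : k ≤ L := fun x hx => by
  rw [h.mem_bot] at hx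
  rw [h.mem_mid, sq, pow_mul, hx, hx]

theorem form_mem (x c : K) : x * c ^ q ^ 2 + x ^ q ^ 2 * c ∈ L := by
  rw [h.mem_mid, h.add_pow, mul_pow, mul_pow, h.pow_pow, h.pow_pow, add_comm]

theorem exists_norm_eq {w : K} (hw : w ∈ L) (hw0 : w ≠ 0) : ∃ z, z ^ (q ^ 2 + 1) = w := by
  obtain ⟨g, hg⟩ := IsCyclic.exists_monoid_generator (α := Kˣ)
  obtain ⟨t, ht⟩ := hg (Units.mk0 w hw0)
  have hord : orderOf g = q ^ 4 - 1 := by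
    rw [orderOf_eq_card_of_forall_mem_zpowers
      (fun x => Submonoid.powers_le_zpowers g (hg x)), Nat.card_units,
      Nat.card_eq_fintype_card, h.card_top]
  have h1 : g ^ (t * (q ^ 2 - 1)) = 1 := by
    rw [pow_mul]
    change (fun n => g ^ n) t = _ at ht
    simp only at ht
    rw [ht]
    ext
    have h2 : w * w ^ (q ^ 2 - 1) = w * 1 := by
      rw [← pow_succ', Nat.sub_add_cancel h.one_lt_sq.le, (h.mem_mid w).1 hw, mul_one]
    simpa using mul_left_cancel₀ hw0 h2
  rw [← orderOf_dvd_iff_pow_eq_one, hord] at h1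
  have h3 : q ^ 4 - 1 = (q ^ 2 + 1) * (q ^ 2 - 1) := by
    rw [← Nat.sq_sub_sq]; ring_nf
  rw [h3] at h1
  obtain ⟨s, rfl⟩ := Nat.dvd_of_mul_dvd_mul_right (by have := h.one_lt_sq; omega) h1
  refine ⟨(g ^ s : Kˣ), ?_⟩
  rw [← Units.val_pow_eq_pow_val, ← pow_mul, mul_comm]
  exact congrArg Units.val ht

variable [Fintype L]

theorem sum_mid_of_forall_ne_zero {a : ℂ} {F : L → ℂ} (hF : ∀ l, l ≠ 0 → F l = a) :
    ∑ l, F l = F 0 + (q ^ 2 - 1) * a := by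
  classical
  rw [Fintype.sum_eq_add_sum_compl 0]
  rw [Finset.sum_congr rfl (g := fun _ => a) fun l hl => hF l (by simpa using hl)]
  rw [Finset.sum_const, Finset.card_compl, Finset.card_singleton, ← Nat.card_eq_fintype_card,
    h.card_mid, nsmul_eq_mul, Nat.cast_pred (by have := h.one_lt_sq; omega)]
  push_cast; rfl

variable {ψ : AddChar K ℂ} (hk : ∀ t ∈ k, ψ t = 1) (hL : ∃ l ∈ L, ψ l ≠ 1)

section

include hL

open Classical in
theorem sum_mid_mul {y : K} (hy : y ∈ L) :
    ∑ l : L, ψ (l * y) = if y = 0 then (q : ℂ) ^ 2 else 0 := by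
  have h1 := AddChar.sum_eq_ite
    (ψ.compAddMonoidHom ((AddMonoidHom.mulRight y).comp (L.subtype : L →+ K)))
  rw [← Nat.card_eq_fintype_card, h.card_mid] at h1
  push_cast at h1
  refine h1.trans (if_congr ?_ rfl rfl)
  rw [AddChar.eq_zero_iff]
  constructor
  · intro h2
    by_contra hy0
    obtain ⟨l, hl, hl1⟩ := hL
    apply hl1
    simpa [hy0] using h2 ⟨l / y, L.div_mem hl hy⟩
  · rintro rfl
    simp

end

section

variable [Fintype k]

include hk hL

open Classical in
omit [Fintype L] in
theorem sum_bot_mul {y : K} (hy : y ∈ L) :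
    ∑ t : k, ψ (t * y) = if y ∈ k then (q : ℂ) else 0 := by
  have h1 := AddChar.sum_eq_ite
    (ψ.compAddMonoidHom ((AddMonoidHom.mulRight y).comp (k.subtype : k →+ K)))
  rw [← Nat.card_eq_fintype_card, h.card_bot] at h1
  refine h1.trans (if_congr ?_ rfl rfl)
  rw [AddChar.eq_zero_iff]
  constructor
  · intro h2
    by_contra hyk
    -- if `y ∉ k`, then `L = k + k y`, so `ψ` would be trivial on all of `L`
    let f : k × k → L := fun a => ⟨a.1 + a.2 * y, L.add_mem (h.bot_le a.1.2)
      (L.mul_mem (h.bot_le a.2.2) hy)⟩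
    have hf : Function.Injective f := by
      rintro ⟨a, b⟩ ⟨a', b'⟩ hab
      have h3 : (a : K) + b * y = a' + b' * y := congrArg Subtype.val hab
      have h4 : (b : K) = b' := by
        by_contra hne
        apply hyk
        have : y = (a' - a) / (b - b') := by
          rw [eq_div_iff (sub_ne_zero.2 hne)]; linear_combination h3
        rw [this]
        exact k.div_mem (k.sub_mem a'.2 a.2) (k.sub_mem b.2 b'.2)
      rw [h4] at h3
      exact Prod.ext (Subtype.ext (add_right_cancel h3)) (Subtype.ext h4)
    have hbij := hf.bijective_of_nat_card_le (by
      rw [Nat.card_prod, h.card_bot, h.card_mid, sq])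
    obtain ⟨l, hl, hl1⟩ := hL
    obtain ⟨⟨a, b⟩, hab⟩ := hbij.2 ⟨l, hl⟩
    have h3 : (a : K) + b * y = l := congrArg Subtype.val hab
    apply hl1
    rw [← h3, AddChar.map_add_eq_mul, hk a a.2, one_mul]
    exact h2 b
  · intro hyk t
    exact hk _ (k.mul_mem t.2 hyk)

end

section

include hL

/-- The Gauss sum of the norm form: it does not depend on `w` because the norm is onto, and the
sum over all `w` in `L` counts the zeros of the norm form. -/
theorem sum_norm {w : K} (hw : w ∈ L) (hw0 : w ≠ 0) :
    ∑ x, ψ (w * x ^ (q ^ 2 + 1)) = -(q : ℂ) ^ 2 := by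
  classical
  have h1 : ∀ l : L, l ≠ 0 → ∑ x, ψ (l * x ^ (q ^ 2 + 1)) = ∑ x, ψ (w * x ^ (q ^ 2 + 1)) := by
    intro l hl
    have hl0 : (l : K) ≠ 0 := by simpa using hl
    obtain ⟨z, hz⟩ := h.exists_norm_eq (L.div_mem hw l.2) (div_ne_zero hw0 hl0)
    have hz0 : z ≠ 0 := by
      rintro rfl
      rw [zero_pow (by simp), eq_comm] at hz
      exact div_ne_zero hw0 hl0 hz
    refine (Fintype.sum_equiv (Equiv.mulLeft₀ z hz0) _ _ fun x => ?_).symm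
    simp only [Equiv.mulLeft₀_apply, mul_pow, hz]
    rw [← mul_assoc, mul_div_cancel₀ _ hl0]
  have h2 := h.sum_mid_of_forall_ne_zero h1
  rw [Finset.sum_comm] at h2
  simp_rw [h.sum_mid_mul hL (h.norm_mem _)] at h2
  have h3 : ∀ x : K, x ^ (q ^ 2 + 1) = 0 ↔ x = 0 := fun x => by simp
  simp_rw [h3] at h2
  simp only [Finset.sum_ite_eq', Finset.mem_univ, if_true, ZeroMemClass.coe_zero, zero_mul,
    AddChar.map_zero_eq_one, Finset.sum_const, Finset.card_univ, h.card_top, nsmul_eq_mul,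
    mul_one] at h2
  push_cast at h2
  apply mul_left_cancel₀ h.sq_sub_one_ne_zero
  linear_combination -h2

/-- Completing the square in the Gauss sum of the norm form. -/
theorem sum_norm_add_form {w : K} (hw : w ∈ L) (hw0 : w ≠ 0) (c : K) :
    ∑ x, ψ (w * x ^ (q ^ 2 + 1)) * ψ (x * c ^ q ^ 2 + x ^ q ^ 2 * c) =
      -(q : ℂ) ^ 2 * ψ (-(c ^ (q ^ 2 + 1) / w)) := by
  have h1 : ∀ x : K, w * (x + c / w) ^ (q ^ 2 + 1) - c ^ (q ^ 2 + 1) / w =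
      w * x ^ (q ^ 2 + 1) + (x * c ^ q ^ 2 + x ^ q ^ 2 * c) := by
    intro x
    rw [pow_succ (x + c / w), h.add_pow, div_pow, (h.mem_mid w).1 hw]
    field_simp
    ring
  simp_rw [← AddChar.map_add_eq_mul, ← h1, sub_eq_add_neg, AddChar.map_add_eq_mul]
  rw [← Finset.sum_mul, ← h.sum_norm hL hw hw0]
  congr 1
  exact Fintype.sum_equiv (Equiv.addRight (c / w)) _ _ (by simp)

theorem form_eq_zero {c : K} (hc : ∀ x, ψ (x * c ^ q ^ 2 + x ^ q ^ 2 * c) = 1) : c = 0 := by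
  classical
  by_contra hc0
  have h1 : ∀ l : L, ψ (l * (c * c ^ q ^ 2 + c ^ q ^ 2 * c)) = 1 := by
    intro l
    rw [← hc (l * c), mul_pow, (h.mem_mid l).1 l.2]
    congr 1; ring
  have h2 := h.sum_mid_mul hL (h.form_mem c c)
  simp_rw [h1] at h2
  rw [if_neg, Finset.sum_const, Finset.card_univ, ← Nat.card_eq_fintype_card, h.card_mid] at h2
  · have := h.one_lt
    simp at h2
    omega
  · rw [mul_comm c, ← two_mul]
    exact mul_ne_zero h.two_ne_zero (mul_ne_zero (pow_ne_zero _ hc0) hc0)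

omit [Fintype L] hL in
theorem form_add (x y c : K) : (x + y) * c ^ q ^ 2 + (x + y) ^ q ^ 2 * c =
    (x * c ^ q ^ 2 + x ^ q ^ 2 * c) + (y * c ^ q ^ 2 + y ^ q ^ 2 * c) := by
  rw [h.add_pow]; ring

theorem sum_form {c : K} (hc : c ≠ 0) : ∑ x, ψ (x * c ^ q ^ 2 + x ^ q ^ 2 * c) = 0 := by
  classical
  let χ : AddChar K ℂ := ψ.compAddMonoidHom
    (AddMonoidHom.mk' (fun x => x * c ^ q ^ 2 + x ^ q ^ 2 * c) fun x y => h.form_add x y c)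
  have h1 := AddChar.sum_eq_ite χ
  rw [if_neg] at h1
  · exact h1
  · intro h0
    exact hc (h.form_eq_zero hL fun x => AddChar.eq_zero_iff.1 h0 x)

/-- Every character of `K` is `x ↦ ψ (Tr (x c'))`, where `Tr` is the trace from `K` to `L` and
`c'` is the conjugate of `c`. -/
theorem exists_form (χ : AddChar K ℂ) :
    ∃ c, ∀ x, χ x = ψ (x * c ^ q ^ 2 + x ^ q ^ 2 * c) := by
  classical
  let f : K → AddChar K ℂ := fun c => ψ.compAddMonoidHom
    (AddMonoidHom.mk' (fun x => x * c ^ q ^ 2 + x ^ q ^ 2 * c) fun x y => h.form_add x y c)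
  have hf : Function.Injective f := by
    intro c c' hcc
    have h1 : ∀ x, ψ (x * c ^ q ^ 2 + x ^ q ^ 2 * c) = ψ (x * c' ^ q ^ 2 + x ^ q ^ 2 * c') :=
      fun x => DFunLike.congr_fun hcc x
    rw [← sub_eq_zero]
    apply h.form_eq_zero hL
    intro x
    have h2 : c ^ q ^ 2 = (c - c') ^ q ^ 2 + c' ^ q ^ 2 := by rw [← h.add_pow, sub_add_cancel]
    have h3 : x * (c - c') ^ q ^ 2 + x ^ q ^ 2 * (c - c') =
        (x * c ^ q ^ 2 + x ^ q ^ 2 * c) - (x * c' ^ q ^ 2 + x ^ q ^ 2 * c') := by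
      rw [h2]; ring
    rw [h3, AddChar.map_sub_eq_div, h1, div_self (AddChar.val_isUnit _ _).ne_zero]
  obtain ⟨c, hc⟩ := ((Fintype.bijective_iff_injective_and_card f).2
    ⟨hf, (AddChar.card_eq).symm⟩).2 χ
  exact ⟨c, fun x => by rw [← hc]; rfl⟩

end

section

variable [Fintype k]

include hk hL

open Classical in
/-- The character values of the cone `N x ∈ N z • k`, where `N` is the norm: this is an elliptic
quadric over `k`. -/
theorem sum_cone {z c : K} (hz : z ≠ 0) (hc : c ≠ 0) :
    (q : ℂ) * ∑ x, (if x ^ (q ^ 2 + 1) / z ^ (q ^ 2 + 1) ∈ k then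
        ψ (x * c ^ q ^ 2 + x ^ q ^ 2 * c) else 0) =
      -(q : ℂ) ^ 2 * ((if c ^ (q ^ 2 + 1) * z ^ (q ^ 2 + 1) ∈ k then (q : ℂ) else 0) - 1) := by
  have hNz : z ^ (q ^ 2 + 1) ≠ 0 := pow_ne_zero _ hz
  have h1 : ∀ x, (q : ℂ) * (if x ^ (q ^ 2 + 1) / z ^ (q ^ 2 + 1) ∈ k then
      ψ (x * c ^ q ^ 2 + x ^ q ^ 2 * c) else 0) =
      ∑ t : k, ψ (t / z ^ (q ^ 2 + 1) * x ^ (q ^ 2 + 1)) *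
        ψ (x * c ^ q ^ 2 + x ^ q ^ 2 * c) := by
    intro x
    have h2 := h.sum_bot_mul hk hL (L.div_mem (h.norm_mem x) (h.norm_mem z))
    rw [← Finset.sum_mul]
    have h3 : ∀ t : k, (t : K) / z ^ (q ^ 2 + 1) * x ^ (q ^ 2 + 1) =
        t * (x ^ (q ^ 2 + 1) / z ^ (q ^ 2 + 1)) := fun t => by ring
    simp_rw [h3]
    rw [h2]
    split_ifs <;> simp
  have h2 : ∀ t : k, ∑ x, ψ (t / z ^ (q ^ 2 + 1) * x ^ (q ^ 2 + 1)) *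
      ψ (x * c ^ q ^ 2 + x ^ q ^ 2 * c) =
      -(q : ℂ) ^ 2 * (ψ ((-t⁻¹ : k) * (c ^ (q ^ 2 + 1) * z ^ (q ^ 2 + 1))) -
        if t = 0 then 1 else 0) := by
    intro t
    by_cases ht : t = 0
    · subst ht
      simp [h.sum_form hL hc]
    · have ht0 : (t : K) ≠ 0 := by simpa using ht
      rw [h.sum_norm_add_form hL (L.div_mem (h.bot_le t.2) (h.norm_mem z)) (div_ne_zero ht0 hNz),
        if_neg ht, sub_zero]
      congr 2
      push_cast
      field_simp
  rw [Finset.mul_sum, Finset.sum_congr rfl fun x _ => h1 x, Finset.sum_comm,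
    Finset.sum_congr rfl fun t _ => h2 t, ← Finset.mul_sum, Finset.sum_sub_distrib]
  congr 2
  · rw [← h.sum_bot_mul hk hL (L.mul_mem (h.norm_mem c) (h.norm_mem z))]
    refine Function.Bijective.sum_comp (e := fun t : k => -t⁻¹) ?_
      (fun t : k => ψ (t * (c ^ (q ^ 2 + 1) * z ^ (q ^ 2 + 1))))
    exact neg_bijective.comp inv_involutive.bijective
  · simp

/-- Fourier transform of a function that is constant on the classes `N x ∈ N z • k` and has
vanishing sum. It is self-dual up to the factor `-q ^ 2`. -/
theorem sum_of_cone_invariant {E : K → ℂ} (h0 : E 0 = 0) (hsum : ∑ x, E x = 0)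
    (hE : ∀ x z, x ≠ 0 → z ≠ 0 → x ^ (q ^ 2 + 1) / z ^ (q ^ 2 + 1) ∈ k → E x = E z)
    {c : K} (hc : c ≠ 0) :
    ∑ x, E x * ψ (x * c ^ q ^ 2 + x ^ q ^ 2 * c) = -(q : ℂ) ^ 2 * E c⁻¹ := by
  classical
  -- `T` is the number of elements of a class, so that `T * E` is a combination of indicators
  let T : ℂ := ∑ z : K, if z ≠ 0 ∧ 1 / z ^ (q ^ 2 + 1) ∈ k then 1 else 0
  have hT : T ≠ 0 := by
    simp only [T]
    rw [Finset.sum_boole, Nat.cast_ne_zero]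
    refine Finset.card_ne_zero_of_mem (a := 1) ?_
    simp [k.one_mem]
  have hA : ∀ x, ∑ z, (if x ^ (q ^ 2 + 1) / z ^ (q ^ 2 + 1) ∈ k then E z else 0) = T * E x := by
    intro x
    by_cases hx : x = 0
    · subst hx
      rw [h0, mul_zero, ← hsum]
      refine Finset.sum_congr rfl fun z _ => ?_
      rw [zero_pow (by simp), zero_div, if_pos k.zero_mem]
    · rw [Finset.sum_mul]
      refine (Fintype.sum_equiv (Equiv.mulLeft₀ x hx) _ _ fun z => ?_).symm
      simp only [Equiv.mulLeft₀_apply]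
      have h1 : x ^ (q ^ 2 + 1) / (x * z) ^ (q ^ 2 + 1) = 1 / z ^ (q ^ 2 + 1) := by
        rw [mul_pow, div_mul_eq_div_div, div_self (pow_ne_zero _ hx)]
      rw [h1]
      by_cases hz : z = 0
      · subst hz; simp [h0]
      · by_cases hzk : 1 / z ^ (q ^ 2 + 1) ∈ k
        · rw [if_pos ⟨hz, hzk⟩, if_pos hzk, one_mul]
          exact hE _ _ hx (mul_ne_zero hx hz) (by rwa [h1])
        · rw [if_neg (fun h => hzk h.2), if_neg hzk, zero_mul]
  have hq : (q : ℂ) ≠ 0 := Nat.cast_ne_zero.2 (by have := h.one_lt; omega)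
  apply mul_left_cancel₀ hT
  apply mul_left_cancel₀ hq
  calc (q : ℂ) * (T * ∑ x, E x * ψ (x * c ^ q ^ 2 + x ^ q ^ 2 * c))
      = q * ∑ x, ∑ z, (if x ^ (q ^ 2 + 1) / z ^ (q ^ 2 + 1) ∈ k then E z else 0) *
          ψ (x * c ^ q ^ 2 + x ^ q ^ 2 * c) := by
        rw [Finset.mul_sum]
        simp_rw [← Finset.sum_mul, hA, mul_assoc]
    _ = ∑ z, E z * (q * ∑ x, (if x ^ (q ^ 2 + 1) / z ^ (q ^ 2 + 1) ∈ k then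
          ψ (x * c ^ q ^ 2 + x ^ q ^ 2 * c) else 0)) := by
        rw [Finset.sum_comm, Finset.mul_sum]
        refine Finset.sum_congr rfl fun z _ => ?_
        rw [mul_left_comm (E z)]
        congr 1
        rw [Finset.mul_sum]
        refine Finset.sum_congr rfl fun x _ => ?_
        split_ifs <;> simp
    _ = ∑ z, (-(q : ℂ) ^ 2 * q * (if (c⁻¹) ^ (q ^ 2 + 1) / z ^ (q ^ 2 + 1) ∈ k then E z else 0)
          + q ^ 2 * E z) := by
        refine Finset.sum_congr rfl fun z _ => ?_
        by_cases hz : z = 0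
        · subst hz; simp [h0]
        · rw [h.sum_cone hk hL hz hc]
          have h1 : (c⁻¹) ^ (q ^ 2 + 1) / z ^ (q ^ 2 + 1) ∈ k ↔
              c ^ (q ^ 2 + 1) * z ^ (q ^ 2 + 1) ∈ k := by
            rw [← inv_mem_iff, inv_pow, inv_div, div_inv_eq_mul, mul_comm]
          simp only [h1]
          split_ifs <;> ring
    _ = q * (T * (-(q : ℂ) ^ 2 * E c⁻¹)) := by
        rw [Finset.sum_add_distrib, ← Finset.mul_sum, ← Finset.mul_sum, hsum, hA]
        ring

end

section

include hL

/-- Fourier transform of a function that is constant on the punctured `L`-lines and whose value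
at `0` is the sum of its values on these lines. Multiplication by `κ` maps a line
to its orthogonal complement under the trace form. -/
theorem sum_of_line_invariant {F : K → ℂ} (hF : ∀ l ∈ L, l ≠ 0 → ∀ x, F (l * x) = F x)
    (hsum : ∑ x, F x = (q : ℂ) ^ 2 * F 0) {κ : K} (hκ0 : κ ≠ 0) (hκ : κ ^ q ^ 2 = -κ)
    {c : K} (hc : c ≠ 0) :
    ∑ x, F x * ψ (x * c ^ q ^ 2 + x ^ q ^ 2 * c) = (q : ℂ) ^ 2 * F (κ * c) := by
  classical
  have hκc : κ * c ≠ 0 := mul_ne_zero hκ0 hc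
  -- the sum of `F x * ψ (l * Tr (x c'))` over all `l` in `L` and all `x` in `K` is evaluated in two
  -- ways: the sum over `x` is independent of `l ≠ 0`, and the sum over `l` detects `Tr (x c') = 0`
  have h1 : ∀ l : L, l ≠ 0 → ∑ x, F x * ψ (l * (x * c ^ q ^ 2 + x ^ q ^ 2 * c)) =
      ∑ x, F x * ψ (x * c ^ q ^ 2 + x ^ q ^ 2 * c) := by
    intro l hl
    have hl0 : (l : K) ≠ 0 := by simpa using hl
    refine Fintype.sum_equiv (Equiv.mulLeft₀ (l : K) hl0) _ _ fun x => ?_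
    simp only [Equiv.mulLeft₀_apply]
    rw [hF l l.2 hl0, mul_pow, (h.mem_mid l).1 l.2]
    congr 2; ring
  have h2 := h.sum_mid_of_forall_ne_zero h1
  have h3 : ∑ l : L, ∑ x, F x * ψ (l * (x * c ^ q ^ 2 + x ^ q ^ 2 * c)) =
      q ^ 2 * ∑ l : L, F (l * (κ * c)) := by
    rw [Finset.sum_comm]
    simp_rw [← Finset.mul_sum, h.sum_mid_mul hL (h.form_mem _ c)]
    rw [Finset.mul_sum]
    calc _ = ∑ x, if x ∈ L then (q : ℂ) ^ 2 * F (x * (κ * c)) else 0 := by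
          refine (Fintype.sum_equiv (Equiv.mulRight₀ (κ * c) hκc) _ _ fun x => ?_).symm
          simp only [Equiv.mulRight₀_apply]
          have h4 : x * (κ * c) * c ^ q ^ 2 + (x * (κ * c)) ^ q ^ 2 * c =
              κ * c * c ^ q ^ 2 * (x - x ^ q ^ 2) := by
            rw [mul_pow, mul_pow, hκ]; ring
          have h5 : x * (κ * c) * c ^ q ^ 2 + (x * (κ * c)) ^ q ^ 2 * c = 0 ↔ x ∈ L := by
            rw [h4, mul_eq_zero, or_iff_right (mul_ne_zero hκc (pow_ne_zero _ hc)), sub_eq_zero,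
              h.mem_mid, eq_comm]
          simp only [h5]
          split_ifs <;> ring
      _ = _ := by
          rw [← Finset.sum_filter]
          exact Finset.sum_subtype _ (by simp) _
  have h4 := h.sum_mid_of_forall_ne_zero (F := fun l : L => F (l * (κ * c))) (a := F (κ * c))
    fun l hl => hF l l.2 (by simpa using hl) _
  rw [h3, h4] at h2
  simp only [ZeroMemClass.coe_zero, zero_mul, AddChar.map_zero_eq_one, mul_one, hsum] at h2
  apply mul_left_cancel₀ h.sq_sub_one_ne_zero
  linear_combination -h2

end

end IsQuarticTower
end CharacterSums

/-! ### Discrete logarithms in a finite field -/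

section DiscreteLog

/-- `g` generates the multiplicative group of `K`, of order `N`, and `D` is a logarithm to the base
`g`. The value `D 0` is arbitrary, and so is the choice of `D x` modulo `N`. -/
structure IsDiscreteLog {K : Type*} [Field K] (N : ℕ) (g : K) (D : K → ℕ) : Prop where
  isPrimitiveRoot : IsPrimitiveRoot g N
  pow_log : ∀ x, x ≠ 0 → g ^ D x = x
  pow_eq_pow_iff : ∀ a b : ℕ, g ^ a = g ^ b ↔ a ≡ b [MOD N]

theorem exists_isDiscreteLog (K : Type*) [Field K] [Fintype K] :
    ∃ (g : K) (D : K → ℕ), IsDiscreteLog (Fintype.card K - 1) g D := by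
  classical
  obtain ⟨g, hg⟩ := IsCyclic.exists_monoid_generator (α := Kˣ)
  have hord : orderOf g = Fintype.card K - 1 := by
    rw [orderOf_eq_card_of_forall_mem_zpowers
      (fun x => Submonoid.powers_le_zpowers g (hg x)), Nat.card_units, Nat.card_eq_fintype_card]
  have h1 : ∀ x : K, ∃ t : ℕ, x ≠ 0 → (g : K) ^ t = x := by
    intro x
    by_cases hx : x = 0
    · exact ⟨0, fun h => absurd hx h⟩
    · obtain ⟨t, ht⟩ := hg (Units.mk0 x hx)
      refine ⟨t, fun _ => ?_⟩
      rw [← Units.val_pow_eq_pow_val]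
      exact congrArg Units.val ht
  choose D hD using h1
  refine ⟨g, D, ?_, hD, fun a b => ?_⟩
  · rw [← hord, IsPrimitiveRoot.coe_units_iff]
    exact IsPrimitiveRoot.orderOf g
  · rw [← hord, ← Units.val_pow_eq_pow_val, ← Units.val_pow_eq_pow_val, Units.val_inj,
      pow_eq_pow_iff_modEq]

namespace IsDiscreteLog

variable {K : Type*} [Field K] {N : ℕ} {g : K} {D : K → ℕ} (hD : IsDiscreteLog N g D)
include hD

theorem log_mul {x y : K} (hx : x ≠ 0) (hy : y ≠ 0) : D (x * y) ≡ D x + D y [MOD N] := by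
  rw [← hD.pow_eq_pow_iff, pow_add, hD.pow_log x hx, hD.pow_log y hy,
    hD.pow_log _ (mul_ne_zero hx hy)]

theorem log_mul_mod_two (hN : 2 ∣ N) {x y : K} (hx : x ≠ 0) (hy : y ≠ 0) :
    D (x * y) % 2 = (D x + D y) % 2 := (hD.log_mul hx hy).of_dvd hN

theorem base_ne_zero (hN : N ≠ 0) : g ≠ 0 := hD.isPrimitiveRoot.ne_zero hN

theorem log_pow (hN : N ≠ 0) (a : ℕ) : D (g ^ a) ≡ a [MOD N] := by
  rw [← hD.pow_eq_pow_iff, hD.pow_log _ (pow_ne_zero _ (hD.base_ne_zero hN))]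

theorem dvd_log_mul {x : K} (hx : x ≠ 0) {e : ℕ} (he : x ^ e = 1) : N ∣ D x * e := by
  rw [← Nat.modEq_zero_iff_dvd, ← hD.pow_eq_pow_iff, pow_mul, hD.pow_log x hx, he, pow_zero]

end IsDiscreteLog

/-- A subfield of fixed points of `x ↦ x ^ r` has `r` elements if `K` contains the roots of unity of
order `r - 1`. -/
theorem card_fixed_points {K : Type*} [Field K] [Fintype K] {r : ℕ} (hr : 1 < r)
    (hdvd : r - 1 ∣ Fintype.card K - 1)
    (S : Subfield K) (hS : ∀ x, x ∈ S ↔ x ^ r = x) : Nat.card S = r := by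
  classical
  obtain ⟨g, -, ⟨hg, -, -⟩⟩ := exists_isDiscreteLog K
  obtain ⟨t, ht⟩ := hdvd
  have hpos : 0 < Fintype.card K - 1 := by
    have := Fintype.one_lt_card (α := K); omega
  have hζ : IsPrimitiveRoot (g ^ t) (r - 1) := hg.pow hpos (by rw [ht, mul_comm])
  have h1 : ∀ x : K, x ∈ insert 0 (Polynomial.nthRootsFinset (r - 1) (1 : K)) ↔ x ∈ S := by
    intro x
    rw [Finset.mem_insert, Polynomial.mem_nthRootsFinset (by omega), hS]
    by_cases hx : x = 0
    · subst hx; simp; omega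
    · have : x ^ r = x ↔ x ^ (r - 1) = 1 := by
        conv_lhs => rw [← Nat.sub_add_cancel hr.le, pow_succ]
        rw [mul_eq_right₀ hx]
      simp [hx, this]
  have h2 : (insert 0 (Polynomial.nthRootsFinset (r - 1) (1 : K))).card = r := by
    rw [Finset.card_insert_of_notMem, hζ.card_nthRootsFinset, Nat.sub_add_cancel hr.le]
    rw [Polynomial.mem_nthRootsFinset (by omega), zero_pow (by omega)]
    exact zero_ne_one
  rw [← h2]
  exact Nat.subtype_card _ h1

end DiscreteLog

theorem exists_isQuarticTower {K : Type*} [Field K] [Fintype K] {p n : ℕ} [Fact p.Prime]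
    [CharP K p] (hn : n ≠ 0) (hodd : Odd (p ^ n)) (hcard : Fintype.card K = (p ^ n) ^ 4) :
    ∃ k L : Subfield K, IsQuarticTower (p ^ n) k L := by
  have hp : p.Prime := Fact.out
  have h1 : 1 < p ^ n := Nat.one_lt_pow hn hp.one_lt
  have hk : ∀ x, x ∈ (iterateFrobenius K p n).eqLocusField (RingHom.id K) ↔ x ^ p ^ n = x :=
    fun x => by rw [RingHom.mem_eqLocusField, iterateFrobenius_def]; rfl
  have hL : ∀ x, x ∈ (iterateFrobenius K p (n * 2)).eqLocusField (RingHom.id K) ↔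
      x ^ (p ^ n) ^ 2 = x :=
    fun x => by rw [RingHom.mem_eqLocusField, iterateFrobenius_def, pow_mul p]; rfl
  refine ⟨_, _, h1, ?_, hk, hL, card_fixed_points h1 ?_ _ hk,
    card_fixed_points (Nat.one_lt_pow two_ne_zero h1) ?_ _ hL, hcard, ?_⟩
  · have hp2 : p ≠ 2 := by
      rintro rfl
      exact (Nat.not_even_iff_odd.2 hodd) ((Nat.even_pow.2 ⟨even_two, hn⟩))
    intro h2
    have : p ∣ 2 := (CharP.cast_eq_zero_iff K p 2).1 (by exact_mod_cast h2)
    exact hp2 ((Nat.prime_dvd_prime_iff_eq hp Nat.prime_two).1 this)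
  · rw [hcard]
    simpa using Nat.sub_dvd_pow_sub_pow (p ^ n) 1 4
  · rw [hcard, show (p ^ n) ^ 4 = ((p ^ n) ^ 2) ^ 2 by ring]
    simpa using Nat.sub_dvd_pow_sub_pow ((p ^ n) ^ 2) 1 2
  · intro x y
    rw [← pow_mul p]
    exact add_pow_char_pow x y p (n * 2)

/-- A character of `K` that is trivial on `k`, but not on `L`. -/
theorem IsQuarticTower.exists_addChar {K : Type*} [Field K] [Fintype K] {q : ℕ}
    {k L : Subfield K} (h : IsQuarticTower q k L) :
    ∃ ψ : AddChar K ℂ, (∀ t ∈ k, ψ t = 1) ∧ ∃ l ∈ L, ψ l ≠ 1 := by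
  obtain ⟨l, hl, hlk⟩ : ∃ l ∈ L, l ∉ k := by
    by_contra! hle
    have h1 : k = L := le_antisymm h.bot_le hle
    have h2 := h.card_mid
    rw [← h1, h.card_bot] at h2
    have := h.one_lt
    nlinarith
  let S : AddSubgroup K := k.toAddSubgroup
  have h1 : (QuotientAddGroup.mk' S) l ≠ 0 := by
    rw [QuotientAddGroup.mk'_apply, Ne, QuotientAddGroup.eq_zero_iff]
    exact hlk
  obtain ⟨χ, hχ⟩ := AddChar.exists_apply_ne_zero.2 h1
  refine ⟨χ.compAddMonoidHom (QuotientAddGroup.mk' S), fun t ht => ?_, l, hl, hχ⟩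
  have h2 : (QuotientAddGroup.mk' S) t = 0 := by
    rw [QuotientAddGroup.mk'_apply, QuotientAddGroup.eq_zero_iff]
    exact ht
  rw [AddChar.compAddMonoidHom_apply, h2, AddChar.map_zero_eq_one]

/-! ### Colour sums -/

section ColourSums

variable {m : ℕ} [NeZero m]

/-- The colour of the integer part of `n / 2` if `n` has the parity `a`, and `0` otherwise. -/
noncomputable def halfColour (m : ℕ) [NeZero m] (a n : ℕ) : ColourRing m :=
  if n % 2 = a then colour ((n / 2 : ℕ) : ZMod m) else 0

theorem halfColour_add_two (a n : ℕ) :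
    halfColour m a (n + 2) = colour 1 * halfColour m a n := by
  unfold halfColour
  rw [Nat.add_mod_right, Nat.add_div_right _ (by norm_num)]
  split_ifs
  · rw [Nat.cast_add, Nat.cast_one, add_comm, colour_add]
  · rw [mul_zero]

theorem halfColour_congr {a n n' : ℕ} (h : n ≡ n' [MOD 2 * m]) :
    halfColour m a n = halfColour m a n' := by
  have h1 : ∀ n : ℕ, halfColour m a (n % (2 * m)) = halfColour m a n := by
    intro n
    have h2 : n % (2 * m) % 2 = n % 2 := Nat.mod_mod_of_dvd _ (dvd_mul_right _ _)
    have h3 : ((n % (2 * m) / 2 : ℕ) : ZMod m) = ((n / 2 : ℕ) : ZMod m) := by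
      rw [Nat.mod_mul_right_div_self]
      exact ZMod.natCast_mod _ _
    unfold halfColour
    rw [h2, h3]
  rw [← h1 n, h, h1]

theorem colour_one_apply_ne_one (j : {j : ZMod m // j ≠ 0}) :
    colour (1 : ZMod m) j ≠ 1 := by
  intro h
  apply j.2
  apply ZMod.injective_stdAddChar
  rw [AddChar.map_zero_eq_one, ← h, colour, mul_one]

/-- Each colour occurs equally often among the `n` numbers of parity `a` below `2 * n`, except for
one more occurrence of the colour `0`. -/
theorem sum_halfColour {a n : ℕ} (ha : a < 2) (hn : n ≡ 1 [MOD m]) :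
    ∑ t ∈ Finset.range (2 * n), halfColour m a t = 1 := by
  have h1 : ∀ n : ℕ, ∑ t ∈ Finset.range (2 * n), halfColour m a t =
      ∑ r ∈ Finset.range n, colour ((r : ℕ) : ZMod m) := by
    intro n
    induction n with
    | zero => simp
    | succ n ih =>
      rw [mul_add, mul_one, Finset.sum_range_succ, Finset.sum_range_succ, ih,
        Finset.sum_range_succ, add_assoc]
      congr 1
      interval_cases a
      · simp [halfColour, Nat.add_mod]
      · have : (2 * n + 1) / 2 = n := by omega
        simp [halfColour, Nat.add_mod, this]
  have h2 : ∀ r : ℕ, colour (r : ZMod m) = colour 1 ^ r := by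
    intro r
    induction r with
    | zero => simp [colour_zero]
    | succ r ih => rw [Nat.cast_add, Nat.cast_one, colour_add, ih, pow_succ]
  rw [h1, Finset.sum_congr rfl fun r _ => h2 r]
  have h3 : (colour (1 : ZMod m)) ^ n = colour 1 := by
    rw [← h2, (ZMod.natCast_eq_natCast_iff n 1 m).2 hn, Nat.cast_one]
  have h4 := mul_geom_sum (colour (1 : ZMod m)) n
  rw [h3] at h4
  ext j
  have h5 := congrFun h4 j
  apply mul_left_cancel₀ (sub_ne_zero.2 (colour_one_apply_ne_one j))
  simpa using h5

theorem sum_range_mul_mod {R : Type*} [CommRing R] (f : ℕ → R) (a b : ℕ) :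
    ∑ t ∈ Finset.range (b * a), f (t % b) = a * ∑ t ∈ Finset.range b, f t := by
  induction a with
  | zero => simp
  | succ a ih =>
    rw [mul_add, mul_one, Finset.sum_range_add, ih, Nat.cast_add, Nat.cast_one, add_mul, one_mul]
    congr 1
    refine Finset.sum_congr rfl fun t ht => ?_
    rw [Nat.mul_add_mod, Nat.mod_eq_of_lt (Finset.mem_range.1 ht)]

end ColourSums

/-! ### The building matrix of a field with `q ^ 4` elements -/

theorem pow_four_sub_one (q : ℕ) : q ^ 4 - 1 = (q ^ 2 + 1) * ((q + 1) * (q - 1)) := by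
  have h1 : q ^ 2 - 1 = (q + 1) * (q - 1) := by simpa using Nat.sq_sub_sq q 1
  have h2 : q ^ 4 - 1 = (q ^ 2 + 1) * (q ^ 2 - 1) := by
    have h3 := Nat.sq_sub_sq (q ^ 2) 1
    rwa [← pow_mul, one_pow] at h3
  rw [h2, h1]

/-- Half the number of lines of `K` over `L` is odd, and congruent to `1` modulo `m`. -/
theorem exists_sq_add_one_eq {q m : ℕ} (hq : 1 < q) (hmq : 2 * m ∣ q + 1) :
    ∃ n, q ^ 2 + 1 = 2 * n ∧ n ≡ 1 [MOD m] ∧ n % 2 = 1 := by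
  obtain ⟨w, hw⟩ := hmq
  obtain ⟨r, rfl⟩ : ∃ r, q = r + 1 := ⟨q - 1, by omega⟩
  obtain ⟨s, rfl⟩ : ∃ s, r = 2 * s := by
    have : r + 1 + 1 = 2 * (m * w) := by rw [hw, mul_assoc]
    exact ⟨r / 2, by omega⟩
  refine ⟨m * w * (2 * s) + 1, ?_, ?_, ?_⟩
  · have : (2 * s + 1) ^ 2 + 1 = (2 * s + 1 + 1) * (2 * s) + 2 := by ring
    rw [this, hw]; ring
  · refine Nat.ModEq.symm ((Nat.modEq_iff_dvd' (by omega)).2 ?_)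
    rw [Nat.add_sub_cancel, mul_assoc]
    exact dvd_mul_right _ _
  · have : m * w * (2 * s) + 1 = 2 * (m * w * s) + 1 := by ring
    omega

section BuildingMatrix

variable {K : Type*} [Field K] [Fintype K] {q m : ℕ} [NeZero m] {k L : Subfield K}

/-- Colouring of the nonzero elements of parity `a`, according to the cyclotomic class modulo
`2 m`. -/
noncomputable def coneColour (m : ℕ) [NeZero m] (D : K → ℕ) (a : ℕ) (x : K) : ColourRing m :=
  open Classical in if x = 0 then 0 else halfColour m a (D x)

/-- Colouring of the lines of parity `a` over the subfield of order `q ^ 2`, numbered by the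
logarithm modulo `q ^ 2 + 1`. The value at `0` is the sum of the values on all these lines. -/
noncomputable def lineColour (m : ℕ) [NeZero m] (q : ℕ) (D : K → ℕ) (a : ℕ) (x : K) :
    ColourRing m :=
  open Classical in if x = 0 then 1 else halfColour m a (D x % (q ^ 2 + 1))

namespace IsQuarticTower

variable (h : IsQuarticTower q k L) {g : K} {D : K → ℕ} (hD : IsDiscreteLog (q ^ 4 - 1) g D)
include h

theorem pow_four_sub_one_ne_zero : q ^ 4 - 1 ≠ 0 := by
  have := Nat.one_lt_pow (n := 4) (by norm_num) h.one_lt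
  omega

include hD

omit [NeZero m] in
theorem log_modEq_of_cone (hmq : 2 * m ∣ q + 1) {x z : K} (hx : x ≠ 0) (hz : z ≠ 0)
    (hxz : x ^ (q ^ 2 + 1) / z ^ (q ^ 2 + 1) ∈ k) : D x ≡ D z [MOD 2 * m] := by
  have hq := h.one_lt
  have h0 : x / z ≠ 0 := div_ne_zero hx hz
  have h1 : (x / z) ^ ((q ^ 2 + 1) * (q - 1)) = 1 := by
    rw [← div_pow, h.mem_bot] at hxz
    rw [pow_mul]
    apply mul_right_cancel₀ (pow_ne_zero (q ^ 2 + 1) h0)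
    rw [← pow_succ, Nat.sub_add_cancel hq.le, hxz, one_mul]
  have h2 := hD.dvd_log_mul h0 h1
  rw [pow_four_sub_one, mul_comm (q + 1), ← mul_assoc, mul_comm (D _)] at h2
  have h3 : q + 1 ∣ D (x / z) :=
    Nat.dvd_of_mul_dvd_mul_left (Nat.mul_pos (by positivity) (by omega)) h2
  have h4 := hD.log_mul h0 hz
  rw [div_mul_cancel₀ _ hz] at h4
  have h5 : 2 * m ∣ q ^ 4 - 1 := by
    rw [pow_four_sub_one]
    exact (hmq.mul_right _).mul_left _
  refine (h4.of_dvd h5).trans ?_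
  have h6 : D (x / z) ≡ 0 [MOD 2 * m] := Nat.modEq_zero_iff_dvd.2 (hmq.trans h3)
  simpa using h6.add_right (D z)

theorem coneColour_congr (hmq : 2 * m ∣ q + 1) (a : ℕ) {x z : K} (hx : x ≠ 0) (hz : z ≠ 0)
    (hxz : x ^ (q ^ 2 + 1) / z ^ (q ^ 2 + 1) ∈ k) :
    coneColour m D a x = coneColour m D a z := by
  rw [coneColour, coneColour, if_neg hx, if_neg hz]
  exact halfColour_congr (h.log_modEq_of_cone hD hmq hx hz hxz)

/-- Multiplication by the square of a generator adds `1` to all colours. -/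
theorem sum_coneColour (hmq : 2 * m ∣ q + 1) (a : ℕ) : ∑ x, coneColour m D a x = 0 := by
  have hN := h.pow_four_sub_one_ne_zero
  have hg : g ^ 2 ≠ 0 := pow_ne_zero _ (hD.base_ne_zero hN)
  have h1 : ∀ x, coneColour m D a (g ^ 2 * x) = colour 1 * coneColour m D a x := by
    intro x
    by_cases hx : x = 0
    · simp [coneColour, hx]
    · rw [coneColour, coneColour, if_neg hx, if_neg (mul_ne_zero hg hx), ← halfColour_add_two]
      apply halfColour_congr
      have h2 := (hD.log_mul hg hx).trans ((hD.log_pow hN 2).add_right (D x))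
      rw [add_comm 2] at h2
      refine h2.of_dvd ?_
      rw [pow_four_sub_one]
      exact (hmq.mul_right _).mul_left _
  have h2 : ∑ x, coneColour m D a x = colour 1 * ∑ x, coneColour m D a x := by
    rw [Finset.mul_sum]
    refine (Fintype.sum_equiv (Equiv.mulLeft₀ _ hg) _ _ fun x => ?_).symm
    simp only [Equiv.mulLeft₀_apply, h1]
  ext j
  have h3 := congrFun h2 j
  by_contra hne
  exact colour_one_apply_ne_one j ((mul_eq_right₀ hne).1 h3.symm)

theorem lineColour_mul (a : ℕ) {l : K} (hl : l ∈ L) (hl0 : l ≠ 0) (x : K) :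
    lineColour m q D a (l * x) = lineColour m q D a x := by
  have hq := h.one_lt
  by_cases hx : x = 0
  · simp [hx]
  · have h1 : l ^ ((q + 1) * (q - 1)) = 1 := by
      have h2 : (q + 1) * (q - 1) = q ^ 2 - 1 := by simpa using (Nat.sq_sub_sq q 1).symm
      apply mul_right_cancel₀ hl0
      rw [h2, ← pow_succ, Nat.sub_add_cancel h.one_lt_sq.le, (h.mem_mid l).1 hl, one_mul]
    have h2 := hD.dvd_log_mul hl0 h1
    rw [pow_four_sub_one] at h2
    have h3 := Nat.dvd_of_mul_dvd_mul_right (Nat.mul_pos (by omega) (by omega)) h2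
    have h4 : D (l * x) ≡ D x [MOD q ^ 2 + 1] := by
      refine ((hD.log_mul hl0 hx).of_dvd ?_).trans ?_
      · rw [pow_four_sub_one]; exact dvd_mul_right _ _
      · simpa using (Nat.modEq_zero_iff_dvd.2 h3).add_right (D x)
    rw [lineColour, lineColour, if_neg hx, if_neg (mul_ne_zero hl0 hx), h4]

theorem sum_lineColour (hmq : 2 * m ∣ q + 1) {a : ℕ} (ha : a < 2) :
    ∑ x, lineColour m q D a x = (q : ColourRing m) ^ 2 := by
  classical
  have hN := h.pow_four_sub_one_ne_zero
  obtain ⟨n, hn, hn1, -⟩ := exists_sq_add_one_eq h.one_lt hmq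
  have hg : g ≠ 0 := hD.base_ne_zero hN
  have h1 : ∑ x ∈ {0}ᶜ, lineColour m q D a x =
      ∑ t ∈ Finset.range (q ^ 4 - 1), halfColour m a (t % (q ^ 2 + 1)) := by
    symm
    refine Finset.sum_bij (fun t _ => g ^ t) ?_ ?_ ?_ ?_
    · intro t _; simp [hg]
    · intro s hs t ht hst
      have := (hD.pow_eq_pow_iff s t).1 hst
      rwa [Nat.ModEq, Nat.mod_eq_of_lt (Finset.mem_range.1 hs),
        Nat.mod_eq_of_lt (Finset.mem_range.1 ht)] at this
    · intro x hx
      refine ⟨D x % (q ^ 4 - 1), Finset.mem_range.2 (Nat.mod_lt _ (Nat.pos_of_ne_zero hN)), ?_⟩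
      rw [(hD.pow_eq_pow_iff _ (D x)).2 (Nat.mod_modEq _ _), hD.pow_log]
      simpa using hx
    · intro t _
      have h2 : D (g ^ t) ≡ t [MOD q ^ 2 + 1] := (hD.log_pow hN t).of_dvd (by
        rw [pow_four_sub_one]; exact dvd_mul_right _ _)
      rw [lineColour, if_neg (pow_ne_zero _ hg), h2]
  have h2 : (((q + 1) * (q - 1) : ℕ) : ColourRing m) + 1 = (q : ColourRing m) ^ 2 := by
    have h3 : (q + 1) * (q - 1) + 1 = q ^ 2 := by
      have h4 : q ^ 2 - 1 = (q + 1) * (q - 1) := by simpa using Nat.sq_sub_sq q 1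
      have := h.one_lt_sq
      omega
    exact_mod_cast congrArg (Nat.cast (R := ColourRing m)) h3
  rw [Fintype.sum_eq_add_sum_compl 0, h1, pow_four_sub_one, sum_range_mul_mod, hn,
    sum_halfColour ha hn1, mul_one, ← h2, add_comm]
  simp [lineColour]

omit [NeZero m] in
/-- The element is a generator raised to the power `(q ^ 2 + 1) / 2`, which is odd. -/
theorem exists_conj_eq_neg (hmq : 2 * m ∣ q + 1) :
    ∃ κ : K, κ ≠ 0 ∧ κ ^ q ^ 2 = -κ ∧ D κ % 2 = 1 := by
  have hN := h.pow_four_sub_one_ne_zero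
  have hg : g ≠ 0 := hD.base_ne_zero hN
  obtain ⟨n, hn, -, hn2⟩ := exists_sq_add_one_eq h.one_lt hmq
  have h1 : q ^ 2 - 1 = (q + 1) * (q - 1) := by simpa using Nat.sq_sub_sq q 1
  have h2 : q ^ 4 - 1 = 2 * (n * (q ^ 2 - 1)) := by
    rw [pow_four_sub_one, hn, h1, mul_assoc]
  have h3 : g ^ (n * (q ^ 2 - 1)) = -1 := by
    have h4 : (g ^ (n * (q ^ 2 - 1))) ^ 2 = 1 := by
      rw [← pow_mul, mul_comm _ 2, ← h2, hD.isPrimitiveRoot.pow_eq_one]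
    refine (mul_self_eq_one_iff.1 ((sq _).symm.trans h4)).resolve_left ?_
    have h5 : 0 < n * (q ^ 2 - 1) := by omega
    exact hD.isPrimitiveRoot.pow_ne_one_of_pos_of_lt h5.ne' (by omega)
  refine ⟨g ^ n, pow_ne_zero _ hg, ?_, ?_⟩
  · rw [← Nat.sub_add_cancel h.one_lt_sq.le, pow_succ, ← pow_mul, h3, neg_one_mul]
  · have h5 : D (g ^ n) ≡ n [MOD 2] := (hD.log_pow hN n).of_dvd (by
      rw [h2]; exact dvd_mul_right _ _)
    rw [h5, hn2]

end IsQuarticTower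

theorem halfColour_mem {a n : ℕ} (hn : n % 2 = a) : halfColour m a n ∈ colours m := by
  rw [halfColour, if_pos hn]; exact colour_mem _

theorem halfColour_eq_zero {a n : ℕ} (hn : n % 2 ≠ a) : halfColour m a n = 0 := if_neg hn

omit [Fintype K] in
/-- With `e = 0` this is the pattern of the building matrix itself; with `e = 1`, the arguments `x`
and `y` being of opposite parity, it is that of the transpose of its Fourier transform. -/
theorem hasPattern_colour {x y : K} {D : K → ℕ} {e : ℕ} (he : e < 2) (hxy : x = 0 ↔ y = 0)
    (hq : 2 ∣ q ^ 2 + 1) (hD : x ≠ 0 → y ≠ 0 → D y % 2 = (D x + e) % 2) :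
    HasPattern (colours m) (x = 0) !![lineColour m q D 0 x, coneColour m D (1 - e) y;
      coneColour m D e y, lineColour m q D 1 x] := by
  by_cases hx : x = 0
  · have hy := hxy.1 hx
    exact Or.inl ⟨hx, by simp [IsDiagonalIn, lineColour, coneColour, hx, hy, one_mem]⟩
  · have hy := mt hxy.2 hx
    have h1 := hD hx hy
    have h2 : D x % (q ^ 2 + 1) % 2 = D x % 2 := Nat.mod_mod_of_dvd _ hq
    refine Or.inr ⟨hx, ?_⟩
    rcases Nat.mod_two_eq_zero_or_one (D x) with h0 | h0
    · left
      simp only [lineColour, coneColour, if_neg hx, if_neg hy]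
      refine ⟨halfColour_mem ?_, halfColour_eq_zero ?_, halfColour_mem ?_,
        halfColour_eq_zero ?_⟩ <;> omega
    · right
      simp only [lineColour, coneColour, if_neg hx, if_neg hy]
      refine ⟨halfColour_eq_zero ?_, halfColour_mem ?_, halfColour_eq_zero ?_,
        halfColour_mem ?_⟩ <;> omega

/-- Multiplication by `κ` changes the parity and inversion does not, so the Fourier transform has
its nonzero entries on a row, and not on a column. -/
theorem IsQuarticTower.exists_isBuildingMatrix (h : IsQuarticTower q k L)
    (hmq : 2 * m ∣ q + 1) :
    ∃ M : K → Matrix (Fin 2) (Fin 2) (ColourRing m), IsBuildingMatrix (q ^ 2) M := by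
  classical
  have : Fintype k := Fintype.ofFinite k
  have : Fintype L := Fintype.ofFinite L
  obtain ⟨ψ, hk, hL⟩ := h.exists_addChar
  obtain ⟨g, D, hD⟩ := exists_isDiscreteLog K
  rw [h.card_top] at hD
  obtain ⟨κ, hκ0, hκ, hκ1⟩ := h.exists_conj_eq_neg hD hmq
  have hq2 : 2 ∣ q ^ 2 + 1 := by
    obtain ⟨n, hn, -⟩ := exists_sq_add_one_eq h.one_lt hmq
    exact ⟨n, hn⟩
  have h2dvd : 2 ∣ q ^ 4 - 1 := by
    rw [pow_four_sub_one]
    exact hq2.mul_right _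
  have hQ : q ^ 2 ≠ 0 := by have := h.one_lt_sq; omega
  have hline : ∀ a, a < 2 → ∀ c, ∑ x, ψ (x * c ^ q ^ 2 + x ^ q ^ 2 * c) • lineColour m q D a x =
      (q ^ 2 : ℂ) • lineColour m q D a (κ * c) := by
    intro a ha c
    ext j
    have hs : ∑ x, lineColour m q D a x j = (q : ℂ) ^ 2 := by
      have := congrFun (h.sum_lineColour hD hmq ha) j
      simpa using this
    simp only [Finset.sum_apply, Pi.smul_apply, smul_eq_mul]
    have h0 : lineColour m q D a 0 j = 1 := by simp [lineColour]
    by_cases hc : c = 0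
    · subst hc
      simp [h0, hs, zero_pow hQ]
    · rw [← h.sum_of_line_invariant hL (F := fun x => lineColour m q D a x j)
        (fun l hl hl0 x => by rw [h.lineColour_mul hD a hl hl0]) (by rw [hs, h0, mul_one])
        hκ0 hκ hc]
      exact Finset.sum_congr rfl fun x _ => mul_comm _ _
  have hcone : ∀ a c, ∑ x, ψ (x * c ^ q ^ 2 + x ^ q ^ 2 * c) • coneColour m D a x =
      (q ^ 2 : ℂ) • -coneColour m D a c⁻¹ := by
    intro a c
    ext j
    have hs : ∑ x, coneColour m D a x j = 0 := by
      have := congrFun (h.sum_coneColour hD hmq a) j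
      simpa using this
    simp only [Finset.sum_apply, Pi.smul_apply, smul_eq_mul]
    have h0 : coneColour m D a 0 j = 0 := by simp [coneColour]
    by_cases hc : c = 0
    · subst hc
      simp [h0, hs, zero_pow hQ]
    · rw [Pi.neg_apply, mul_neg, ← neg_mul, ← h.sum_of_cone_invariant hk hL
        (E := fun x => coneColour m D a x j) h0 hs
        (fun x z hx hz hxz => by rw [h.coneColour_congr hD hmq a hx hz hxz]) hc]
      exact Finset.sum_congr rfl fun x _ => mul_comm _ _
  refine ⟨fun x => !![lineColour m q D 0 x, coneColour m D 1 x;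
      coneColour m D 0 x, lineColour m q D 1 x], fun x => ?_, fun x => ?_, fun χ => ?_⟩
  · exact hasPattern_colour (e := 0) (by norm_num) Iff.rfl hq2 fun _ _ => rfl
  · have h1 : ∀ a, lineColour m q D a (-x) = lineColour m q D a x := fun a => by
      rw [← neg_one_mul, h.lineColour_mul hD a (L.neg_mem L.one_mem) (by simp)]
    have h2 : ∀ a, coneColour m D a (-x) = coneColour m D a x := fun a => by
      by_cases hx : x = 0
      · simp [hx]
      · refine h.coneColour_congr hD hmq a (neg_ne_zero.2 hx) hx ?_
        rw [(even_iff_two_dvd.2 hq2).neg_pow, div_self (pow_ne_zero _ hx)]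
        exact k.one_mem
    simp only [h1, h2]
  · obtain ⟨c, hc⟩ := h.exists_form hL χ
    have hc0 : χ = 0 ↔ c = 0 := by
      constructor
      · rintro rfl
        exact h.form_eq_zero hL fun x => by rw [← hc]; rfl
      · rintro rfl
        rw [AddChar.eq_zero_iff]
        intro x
        simp [hc, zero_pow hQ]
    refine ⟨!![lineColour m q D 0 (κ * c), coneColour m D 1 c⁻¹;
      coneColour m D 0 c⁻¹, lineColour m q D 1 (κ * c)], ?_, ?_⟩
    · have ht : (!![lineColour m q D 0 (κ * c), coneColour m D 1 c⁻¹;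
          coneColour m D 0 c⁻¹, lineColour m q D 1 (κ * c)]).transpose =
          !![lineColour m q D 0 (κ * c), coneColour m D (1 - 1) c⁻¹;
            coneColour m D 1 c⁻¹, lineColour m q D 1 (κ * c)] := by
        ext i j : 2
        fin_cases i <;> fin_cases j <;> rfl
      rw [ht]
      refine (hasPattern_colour (e := 1) (by norm_num) (by simp [hκ0]) hq2 ?_).congr
        (by simp [hκ0, hc0])
      intro _ hc1
      have hc2 : c ≠ 0 := by simpa using hc1
      have h1 := hD.log_mul_mod_two h2dvd hκ0 hc2
      have h2 := hD.log_mul_mod_two h2dvd hc1 hc2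
      have h3 : D 1 % 2 = 0 := by
        have := hD.log_mul_mod_two h2dvd one_ne_zero (one_ne_zero (α := K))
        rw [one_mul] at this
        omega
      rw [inv_mul_cancel₀ hc2] at h2
      omega
    · rw [signMatrix_conj, Nat.cast_pow]
      refine Matrix.ext fun i j => ?_
      rw [Matrix.sum_apply]
      simp only [Matrix.smul_apply, hc]
      fin_cases i <;> fin_cases j
      · exact hline 0 (by norm_num) c
      · exact hcone 1 c
      · exact hcone 0 c
      · exact hline 1 (by norm_num) c

end BuildingMatrix

/-! ### Elementary abelian groups and their products -/

theorem IsElementaryAbelian.exists_isBuildingMatrix {m q : ℕ} [NeZero m] {A : Type*}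
    [AddCommGroup A] [Fintype A] (hA : IsElementaryAbelian A) (hq : IsPrimePow q)
    (hmq : 2 * m ∣ q + 1) (hcard : Fintype.card A = q ^ 4) :
    ∃ M : A → Matrix (Fin 2) (Fin 2) (ColourRing m), IsBuildingMatrix (q ^ 2) M := by
  obtain ⟨p, hp, hpA⟩ := hA
  obtain ⟨p', n, hp', hn, rfl⟩ := (isPrimePow_nat_iff _).1 hq
  have : Fact p.Prime := ⟨hp⟩
  let : Module (ZMod p) A := AddCommGroup.zmodModule hpA
  have h1 : Fintype.card A = p ^ Module.finrank (ZMod p) A := by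
    rw [Module.card_eq_pow_finrank (K := ZMod p), ZMod.card]
  have h2 : p' = p := by
    rw [h1, ← pow_mul] at hcard
    have h3 : p' ∣ p ^ Module.finrank (ZMod p) A := by
      rw [hcard]; exact dvd_pow_self _ (by omega)
    exact (Nat.prime_dvd_prime_iff_eq hp' hp).1 (hp'.dvd_of_dvd_pow h3)
  subst h2
  have h4 : Module.finrank (ZMod p') A = n * 4 := by
    rw [h1, ← pow_mul] at hcard
    exact Nat.pow_right_injective hp'.two_le hcard
  have : Fintype (GaloisField p' (n * 4)) := Fintype.ofFinite _
  have h5 : Fintype.card (GaloisField p' (n * 4)) = (p' ^ n) ^ 4 := by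
    rw [← Nat.card_eq_fintype_card, GaloisField.card _ _ (by omega), pow_mul]
  have hodd : Odd (p' ^ n) := by
    rw [Nat.odd_iff]
    have : 2 ∣ p' ^ n + 1 := (dvd_mul_right 2 m).trans hmq
    omega
  obtain ⟨k, L, h⟩ := exists_isQuarticTower hn.ne' hodd h5
  obtain ⟨M, hM⟩ := h.exists_isBuildingMatrix hmq
  let e : A ≃ₗ[ZMod p'] GaloisField p' (n * 4) := LinearEquiv.ofFinrankEq _ _ (by
    rw [h4, GaloisField.finrank _ (by omega)])
  exact ⟨_, hM.comp_addEquiv e.toAddEquiv⟩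

/-- There are connection sets `D x`, `x : Fin m`, whose Cayley graphs decompose the complete graph
on `∀ i, G i`, such that the union of any `#I` of them has negative Latin square parameters with
`c = #I * (u - 1) / m` (an exact quotient), and is neither edgeless nor complete if
`0 < #I < m`. -/
theorem theorem1p3 (m : ℕ) (hm : 0 < m) (s : ℕ) (hs : 0 < s)
    (q : Fin s → ℕ) (hq : ∀ i, IsPrimePow (q i)) (hmq : ∀ i, 2 * m ∣ q i + 1)
    (G : Fin s → Type*) [∀ i, AddCommGroup (G i)] [∀ i, Fintype (G i)]
    (hG : ∀ i, IsElementaryAbelian (G i)) (hcard : ∀ i, Fintype.card (G i) = q i ^ 4)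
    (u : ℕ) (hu : u = ∏ i, q i ^ 2) :
    ∃ D : Fin m → Set (∀ i, G i),
      (∀ x, IsConnectionSet (D x)) ∧
      (∀ a b : ∀ i, G i, a ≠ b → ∃! x, (SimpleGraph.addCayley (D x)).Adj a b) ∧
      ∀ I : Finset (Fin m), ∃ c : ℕ, (m : ℤ) * c = I.card * ((u : ℤ) - 1) ∧
        IsConnectionSet (⋃ x ∈ I, D x) ∧
        HasNegativeLatinSquareParameters (SimpleGraph.addCayley (⋃ x ∈ I, D x)) u c ∧
        (0 < I.card → I.card < m →
          SimpleGraph.addCayley (⋃ x ∈ I, D x) ≠ ⊥ ∧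
          SimpleGraph.addCayley (⋃ x ∈ I, D x) ≠ ⊤) := by
  have : NeZero m := ⟨hm.ne'⟩
  obtain ⟨M, hM⟩ := IsBuildingMatrix.exists_pi (m := m) s G (fun i => q i ^ 2)
    fun i => (hG i).exists_isBuildingMatrix (hq i) (hmq i) (hcard i)
  rw [← hu] at hM
  obtain ⟨f, hf⟩ := hM.exists_colouring
  have hpos : 0 < u := by
    rw [hu]
    exact Finset.prod_pos fun i _ => pow_pos (hq i).pos 2
  refine hf.exists_decomposition ?_ ?_ ?_
  · rw [Fintype.card_pi, hu, ← Finset.prod_pow]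
    refine Finset.prod_congr rfl fun i _ => ?_
    rw [hcard, ← pow_mul]
  · have h1 : q ⟨0, hs⟩ ^ 2 ∣ u := by
      rw [hu]
      exact Finset.dvd_prod_of_mem (fun i => q i ^ 2) (Finset.mem_univ _)
    exact (Nat.one_lt_pow two_ne_zero (hq _).one_lt).trans_le (Nat.le_of_dvd hpos h1)
  · have h1 : ∀ i, q i ^ 2 ≡ 1 [MOD m] := by
      intro i
      refine ((Nat.modEq_iff_dvd' (Nat.one_le_pow _ _ (hq i).pos)).2 ?_).symm
      have h2 := Nat.sq_sub_sq (q i) 1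
      rw [one_pow] at h2
      rw [h2]
      exact ((dvd_mul_left m 2).trans (hmq i)).mul_right _
    have h2 : ∏ i, q i ^ 2 ≡ 1 [MOD m] := by
      refine Finset.prod_induction _ (fun a => a ≡ 1 [MOD m]) (fun a b ha hb => ?_) rfl
        fun i _ => h1 i
      simpa using ha.mul hb
    rw [← hu] at h2
    exact (Nat.modEq_iff_dvd' hpos).1 h2.symm
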